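/- Let $s\in L^1_{loc}(\mathbb R)$ and $Q,r\in L^2_{loc}(\mathbb R)$ be complex-valued, $q:=s+Q'$ (derivative in the sense of distributions), and consider on $\mathbb R$ the formal differential expression $$l[u]=-u''+qu+i[(ru)'+ru'].$$ Put $G_1:=Q+ir$, $G_2:=Q-ir$, and define the quasi-derivatives $$u^{[1]}:=u'-G_1u,\qquad u^{[2]}:=(u^{[1]})'+G_2u^{[1]}+(G_1G_2-s)u,$$ $$v^{\{1\}}:=v'-\overline{G_2}\,v,\qquad v^{\{2\}}:=(v^{\{1\}})'+\overline{G_1}\,v^{\{1\}}+(\overline{G_1G_2}-\overline{s})v.$$ The expression $l$ and its Lagrange adjoint are understood as $l[u]:=-u^{[2]}$ for $u,u^{[1]}\in \mathrm{AC}_{loc}(\mathbb R)$ and $l^+[v]:=-v^{\{2\}}$ for $v,v^{\{1\}}\in \mathrm{AC}_{loc}(\mathbb R)$. In the complex Hilbert space $L^2(\mathbb R)$, with $(f,g)=\int_{\mathbb R} f\overline g\,dx$, let $\mathrm Lu:=l[u]$ and $\mathrm L^+v:=l^+[v]$ be the maximal operators, with domains $$\mathrm{Dom}(\mathrm L)=\{u\in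 L^2(\mathbb R): u,u^{[1]}\in \mathrm{AC}_{loc}(\mathbb R),\ l[u]\in L^2(\mathbb R)\},$$ $$\mathrm{Dom}(\mathrm L^+)=\{v\in L^2(\mathbb R): v,v^{\{1\}}\in \mathrm{AC}_{loc}(\mathbb R),\ l^+[v]\in L^2(\mathbb R)\};$$ let the pre-minimal operators $\mathrm L_{00}$, $\mathrm L_{00}^+$ be the restrictions of $\mathrm L$, $\mathrm L^+$ to the compactly supported elements of their domains, and let the minimal operators $\mathrm L_0$, $\mathrm L_0^+$ be the closures of $\mathrm L_{00}$, $\mathrm L_{00}^+$. Put $[u,v](x):=u(x)\overline{v^{\{1\}}(x)}-u^{[1]}(x)\overline{v(x)}$. Then: 1. $\mathrm L_{00}$ and $\mathrm L_{00}^+$ are densely defined in $L^2(\mathbb R)$. 2. $(\mathrm L_{00})^*=\mathrm L^+$ and $(\mathrm L_{00}^+)^*=\mathrm L$. 3. $\mathrm L$ and $\mathrm L^+$ are closed, and $\mathrm L_{00}$ and $\mathrm L_{00}^+$ are closable. 4. For all $u\in\mathrm{Dom}(\mathrm L)$, $v\in\mathrm{Dom}(\mathrm L^+)$ the finite limits $[u,v](\pm\infty):=\lim_{x\to\pm\infty}[u,v](x)$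 exist and, with $[u,v]_{-\infty}^{\infty}:=[u,v](\infty)-[u,v](-\infty)$, $$\mathrm{Dom}(\mathrm L_0)=\{u\in\mathrm{Dom}(\mathrm L): [u,v]_{-\infty}^{\infty}=0\ \ \forall v\in\mathrm{Dom}(\mathrm L^+)\},$$ $$\mathrm{Dom}(\mathrm L_0^+)=\{v\in\mathrm{Dom}(\mathrm L^+): [u,v]_{-\infty}^{\infty}=0\ \ \forall u\in\mathrm{Dom}(\mathrm L)\}.$$ Moreover $\mathrm{Dom}(\mathrm L),\mathrm{Dom}(\mathrm L^+)\subset W^1_{2,loc}(\mathbb R)$ and $\mathrm{Dom}(\mathrm L_{00}),\mathrm{Dom}(\mathrm L_{00}^+)\subset W^1_{2,comp}(\mathbb R)$. 5. For every $u\in\mathrm{Dom}(\mathrm L_{00})$ the integrals below converge absolutely and $$(\mathrm L_{00}u,u)=\int_{\mathbb R}|u'|^2dx-\int_{\mathbb R}\left(G_1u\overline{u}'+G_2u'\overline u\right)dx+\int_{\mathbb R}s|u|^2dx .$$ -/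

import Mathlib

open MeasureTheory Filter Topology Set
open scoped ComplexConjugate ContDiff InnerProductSpace LinearPMap

namespace QuasiDiff

noncomputable section

/-- The complex Hilbert space `L²(ℝ)`. -/
abbrev L2 : Type := Lp ℂ 2 (volume : Measure ℝ)

/-- `f ∈ L^p_loc(ℝ)`. -/
def MemLpLoc (f : ℝ → ℂ) (p : ENNReal) : Prop :=
  ∀ K : Set ℝ, IsCompact K → MemLp f p (volume.restrict K)

/-- `u ∈ AC_loc(ℝ)`: absolutely continuous on every compact interval. -/
def ACLoc (u : ℝ → ℂ) : Prop :=
  ∀ a b : ℝ, AbsolutelyContinuousOnInterval u a b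

/-- An almost everywhere defined function `f` belongs to `AC_loc(ℝ)` if it agrees almost
everywhere with a locally absolutely continuous function. -/
def HasACRep (f : ℝ → ℂ) : Prop :=
  ∃ u : ℝ → ℂ, ACLoc u ∧ u =ᵐ[volume] f

open Classical in
/-- The (unique) locally absolutely continuous representative of `f`, if there is one
(and `f` itself otherwise). -/
def acRep (f : ℝ → ℂ) : ℝ → ℂ :=
  if h : HasACRep f then h.choose else f

/-- The function `u' - G₁ u`, defined almost everywhere for `u ∈ AC_loc(ℝ)`. -/
def preQuasiDeriv (G₁ u : ℝ → ℂ) : ℝ → ℂ :=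
  fun x => deriv u x - G₁ x * u x

/-- The first quasi-derivative `u^{[1]} = u' - G₁ u` (its `AC_loc` representative). -/
def quasiDeriv₁ (G₁ u : ℝ → ℂ) : ℝ → ℂ :=
  acRep (preQuasiDeriv G₁ u)

/-- The second quasi-derivative
`u^{[2]} = (u^{[1]})' + G₂ u^{[1]} + (G₁ G₂ - s) u`. -/
def quasiDeriv₂ (G₁ G₂ s u : ℝ → ℂ) : ℝ → ℂ :=
  fun x => deriv (quasiDeriv₁ G₁ u) x + G₂ x * quasiDeriv₁ G₁ u x
    + (G₁ x * G₂ x - s x) * u x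

/-- The quasi-differential expression `l[u] = -u^{[2]}`. -/
def quasiExpr (G₁ G₂ s u : ℝ → ℂ) : ℝ → ℂ :=
  fun x => -quasiDeriv₂ G₁ G₂ s u x

/-! Facts needed to see that the maximal operator is well defined and linear. -/

lemma ACLoc.continuous {u : ℝ → ℂ} (hu : ACLoc u) : Continuous u := by
  rw [continuous_iff_continuousAt]
  intro x
  have h := (hu (x - 1) (x + 1)).continuousOn
  rw [uIcc_of_le (by linarith)] at h
  exact h.continuousAt (Icc_mem_nhds (by linarith) (by linarith))

lemma ACLoc.ae_differentiableAt {u : ℝ → ℂ} (hu : ACLoc u) :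
    ∀ᵐ x : ℝ, DifferentiableAt ℝ u x := by
  apply LocallyBoundedVariationOn.ae_differentiableAt
  intro a b _ _
  by_cases hab : a ≤ b
  · have h := (hu a b).boundedVariationOn
    rw [uIcc_of_le hab] at h
    simpa using h
  · rw [Icc_eq_empty hab, inter_empty]
    simp [BoundedVariationOn]

lemma ACLoc.zero : ACLoc (0 : ℝ → ℂ) := by
  intro a b
  rw [absolutelyContinuousOnInterval_iff]
  intro ε hε
  exact ⟨1, one_pos, fun E _ _ => by simpa using hε⟩

lemma ACLoc.add {u w : ℝ → ℂ} (hu : ACLoc u) (hw : ACLoc w) : ACLoc (u + w) :=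
  fun a b => (hu a b).add (hw a b)

lemma ACLoc.smul {u : ℝ → ℂ} (c : ℂ) (hu : ACLoc u) : ACLoc (c • u) :=
  fun a b => (hu a b).const_smul c

lemma acRep_spec {f : ℝ → ℂ} (h : HasACRep f) : ACLoc (acRep f) ∧ acRep f =ᵐ[volume] f := by
  rw [acRep, dif_pos h]
  exact h.choose_spec

lemma acRep_eq {f u : ℝ → ℂ} (hu : ACLoc u) (h : u =ᵐ[volume] f) : acRep f = u := by
  have hs := acRep_spec ⟨u, hu, h⟩
  exact Continuous.ae_eq_iff_eq volume hs.1.continuous hu.continuous |>.1 (hs.2.trans h.symm)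

lemma quasiDeriv₁_zero (G₁ : ℝ → ℂ) :
    HasACRep (preQuasiDeriv G₁ 0) ∧ quasiDeriv₁ G₁ 0 = 0 := by
  have h : (0 : ℝ → ℂ) =ᵐ[volume] preQuasiDeriv G₁ 0 := by
    refine Eventually.of_forall fun x => ?_
    simp [preQuasiDeriv]
  exact ⟨⟨0, ACLoc.zero, h⟩, acRep_eq ACLoc.zero h⟩

lemma quasiDeriv₁_add {G₁ u w : ℝ → ℂ} (hu : ACLoc u) (hw : ACLoc w)
    (hu' : HasACRep (preQuasiDeriv G₁ u)) (hw' : HasACRep (preQuasiDeriv G₁ w)) :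
    HasACRep (preQuasiDeriv G₁ (u + w)) ∧
      quasiDeriv₁ G₁ (u + w) = quasiDeriv₁ G₁ u + quasiDeriv₁ G₁ w := by
  have hac := (acRep_spec hu').1.add (acRep_spec hw').1
  have h : acRep (preQuasiDeriv G₁ u) + acRep (preQuasiDeriv G₁ w)
      =ᵐ[volume] preQuasiDeriv G₁ (u + w) := by
    filter_upwards [(acRep_spec hu').2, (acRep_spec hw').2, hu.ae_differentiableAt,
      hw.ae_differentiableAt] with x h1 h2 h3 h4
    simp only [Pi.add_apply, h1, h2, preQuasiDeriv, deriv_add h3 h4]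
    ring
  exact ⟨⟨_, hac, h⟩, acRep_eq hac h⟩

lemma quasiDeriv₁_smul {G₁ u : ℝ → ℂ} (c : ℂ) (hu : ACLoc u)
    (hu' : HasACRep (preQuasiDeriv G₁ u)) :
    HasACRep (preQuasiDeriv G₁ (c • u)) ∧
      quasiDeriv₁ G₁ (c • u) = c • quasiDeriv₁ G₁ u := by
  have hac := (acRep_spec hu').1.smul c
  have h : c • acRep (preQuasiDeriv G₁ u) =ᵐ[volume] preQuasiDeriv G₁ (c • u) := by
    filter_upwards [(acRep_spec hu').2, hu.ae_differentiableAt] with x h1 h3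
    simp only [Pi.smul_apply, h1, preQuasiDeriv, deriv_const_smul c h3, smul_eq_mul]
    ring
  exact ⟨⟨_, hac, h⟩, acRep_eq hac h⟩

lemma quasiExpr_zero (G₁ G₂ s : ℝ → ℂ) : quasiExpr G₁ G₂ s 0 = 0 := by
  funext x
  simp [quasiExpr, quasiDeriv₂, (quasiDeriv₁_zero G₁).2]

lemma quasiExpr_add {G₁ G₂ s u w : ℝ → ℂ} (hu : ACLoc u) (hw : ACLoc w)
    (hu' : HasACRep (preQuasiDeriv G₁ u)) (hw' : HasACRep (preQuasiDeriv G₁ w)) :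
    quasiExpr G₁ G₂ s (u + w) =ᵐ[volume] quasiExpr G₁ G₂ s u + quasiExpr G₁ G₂ s w := by
  filter_upwards [(acRep_spec hu').1.ae_differentiableAt,
    (acRep_spec hw').1.ae_differentiableAt] with x h1 h2
  have h1 : DifferentiableAt ℝ (quasiDeriv₁ G₁ u) x := h1
  have h2 : DifferentiableAt ℝ (quasiDeriv₁ G₁ w) x := h2
  simp only [quasiExpr, quasiDeriv₂, (quasiDeriv₁_add hu hw hu' hw').2, deriv_add h1 h2,
    Pi.add_apply]
  ring

lemma quasiExpr_smul {G₁ G₂ s u : ℝ → ℂ} (c : ℂ) (hu : ACLoc u)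
    (hu' : HasACRep (preQuasiDeriv G₁ u)) :
    quasiExpr G₁ G₂ s (c • u) =ᵐ[volume] c • quasiExpr G₁ G₂ s u := by
  filter_upwards [(acRep_spec hu').1.ae_differentiableAt] with x h1
  have h1 : DifferentiableAt ℝ (quasiDeriv₁ G₁ u) x := h1
  simp only [quasiExpr, quasiDeriv₂, (quasiDeriv₁_smul c hu hu').2, deriv_const_smul c h1,
    Pi.smul_apply, smul_eq_mul]
  ring

lemma acRep_L2_zero : HasACRep (0 : L2) ∧ acRep (0 : L2) = 0 := by
  have h : (0 : ℝ → ℂ) =ᵐ[volume] (0 : L2) := (Lp.coeFn_zero ℂ 2 volume).symm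
  exact ⟨⟨0, ACLoc.zero, h⟩, acRep_eq ACLoc.zero h⟩

lemma acRep_L2_add {f g : L2} (hf : HasACRep f) (hg : HasACRep g) :
    HasACRep (f + g : L2) ∧ acRep (f + g : L2) = acRep f + acRep g := by
  have hac := (acRep_spec hf).1.add (acRep_spec hg).1
  have h : acRep f + acRep g =ᵐ[volume] (f + g : L2) :=
    ((acRep_spec hf).2.add (acRep_spec hg).2).trans (Lp.coeFn_add f g).symm
  exact ⟨⟨_, hac, h⟩, acRep_eq hac h⟩

lemma acRep_L2_smul (c : ℂ) {f : L2} (hf : HasACRep f) :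
    HasACRep (c • f : L2) ∧ acRep (c • f : L2) = c • acRep f := by
  have hac := (acRep_spec hf).1.smul c
  have h : c • acRep f =ᵐ[volume] (c • f : L2) :=
    ((acRep_spec hf).2.const_smul c).trans (Lp.coeFn_smul c f).symm
  exact ⟨⟨_, hac, h⟩, acRep_eq hac h⟩

/-- `{u ∈ L²(ℝ) : u, u^{[1]} ∈ AC_loc(ℝ), l[u] ∈ L²(ℝ)}`. -/
def maxDomain (G₁ G₂ s : ℝ → ℂ) : Submodule ℂ L2 where
  carrier := {f : L2 | HasACRep f ∧ HasACRep (preQuasiDeriv G₁ (acRep f)) ∧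
    MemLp (quasiExpr G₁ G₂ s (acRep f)) 2 volume}
  zero_mem' := by
    refine ⟨acRep_L2_zero.1, ?_, ?_⟩
    · rw [acRep_L2_zero.2]
      exact (quasiDeriv₁_zero G₁).1
    · rw [acRep_L2_zero.2, quasiExpr_zero]
      exact MemLp.zero
  add_mem' := by
    rintro f g ⟨hf, hf1, hf2⟩ ⟨hg, hg1, hg2⟩
    have e := acRep_L2_add hf hg
    refine ⟨e.1, ?_, ?_⟩
    · rw [e.2]
      exact (quasiDeriv₁_add (acRep_spec hf).1 (acRep_spec hg).1 hf1 hg1).1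
    · rw [e.2]
      exact (memLp_congr_ae (quasiExpr_add (acRep_spec hf).1 (acRep_spec hg).1 hf1 hg1)).2
        (hf2.add hg2)
  smul_mem' := by
    rintro c f ⟨hf, hf1, hf2⟩
    have e := acRep_L2_smul c hf
    refine ⟨e.1, ?_, ?_⟩
    · rw [e.2]
      exact (quasiDeriv₁_smul c (acRep_spec hf).1 hf1).1
    · rw [e.2]
      exact (memLp_congr_ae (quasiExpr_smul c (acRep_spec hf).1 hf1)).2 (hf2.const_smul c)

/-- The maximal operator `u ↦ l[u]` in `L²(ℝ)`. -/
def maxOp (G₁ G₂ s : ℝ → ℂ) : L2 →ₗ.[ℂ] L2 where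
  domain := maxDomain G₁ G₂ s
  toFun :=
    { toFun := fun f => f.2.2.2.toLp (quasiExpr G₁ G₂ s (acRep (f : L2)))
      map_add' := by
        rintro ⟨f, hf, hf1, hf2⟩ ⟨g, hg, hg1, hg2⟩
        rw [← MemLp.toLp_add]
        apply MemLp.toLp_congr
        simp only [Submodule.coe_add, (acRep_L2_add hf hg).2]
        exact quasiExpr_add (acRep_spec hf).1 (acRep_spec hg).1 hf1 hg1
      map_smul' := by
        rintro c ⟨f, hf, hf1, hf2⟩
        rw [RingHom.id_apply, ← MemLp.toLp_const_smul]
        apply MemLp.toLp_congr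
        simp only [Submodule.coe_smul, (acRep_L2_smul c hf).2]
        exact quasiExpr_smul c (acRep_spec hf).1 hf1 }

/-- The elements of `L²(ℝ)` with compact (essential) support. -/
def compactSupp : Submodule ℂ L2 where
  carrier := {f : L2 | ∃ K : Set ℝ, IsCompact K ∧ ∀ᵐ x : ℝ, x ∉ K → f x = 0}
  zero_mem' := by
    refine ⟨∅, isCompact_empty, ?_⟩
    filter_upwards [Lp.coeFn_zero ℂ 2 (volume : Measure ℝ)] with x hx _
    rw [hx]
    rfl
  add_mem' := by
    rintro f g ⟨K, hK, hf⟩ ⟨K', hK', hg⟩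
    refine ⟨K ∪ K', hK.union hK', ?_⟩
    filter_upwards [hf, hg, Lp.coeFn_add f g] with x h1 h2 h3 hx
    rw [mem_union, not_or] at hx
    have h4 : (f + g : L2) x = 0 := by rw [h3, Pi.add_apply, h1 hx.1, h2 hx.2, add_zero]
    exact h4
  smul_mem' := by
    rintro c f ⟨K, hK, hf⟩
    refine ⟨K, hK, ?_⟩
    filter_upwards [hf, Lp.coeFn_smul c f] with x h1 h3 hx
    have h4 : (c • f : L2) x = 0 := by rw [h3, Pi.smul_apply, h1 hx, smul_zero]
    exact h4

/-! The objects attached to `l[u] = -u'' + q u + i[(r u)' + r u']`, `q = s + Q'`. -/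

/-- `G₁ = Q + i r`. -/
def G₁ (Q r : ℝ → ℂ) : ℝ → ℂ := fun x => Q x + Complex.I * r x

/-- `G₂ = Q - i r`. -/
def G₂ (Q r : ℝ → ℂ) : ℝ → ℂ := fun x => Q x - Complex.I * r x

/-- The pointwise complex conjugate of a function. -/
def conjFun (f : ℝ → ℂ) : ℝ → ℂ := fun x => conj (f x)

/-- The maximal operator `L` generated by `l`. -/
def opL (Q r s : ℝ → ℂ) : L2 →ₗ.[ℂ] L2 :=
  maxOp (G₁ Q r) (G₂ Q r) s

/-- The maximal operator `L⁺` generated by the Lagrange adjoint expression `l⁺`, whose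
quasi-derivatives are `v^{1} = v' - conj G₂ · v` and
`v^{2} = (v^{1})' + conj G₁ · v^{1} + (conj G₂ · conj G₁ - conj s) v`, `l⁺[v] = -v^{2}`. -/
def opLPlus (Q r s : ℝ → ℂ) : L2 →ₗ.[ℂ] L2 :=
  maxOp (conjFun (G₂ Q r)) (conjFun (G₁ Q r)) (conjFun s)

/-- The pre-minimal operator `L₀₀`. -/
def opL00 (Q r s : ℝ → ℂ) : L2 →ₗ.[ℂ] L2 :=
  (opL Q r s).domRestrict compactSupp

/-- The pre-minimal operator `L₀₀⁺`. -/
def opL00Plus (Q r s : ℝ → ℂ) : L2 →ₗ.[ℂ] L2 :=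
  (opLPlus Q r s).domRestrict compactSupp

/-- The minimal operator `L₀`, the closure of `L₀₀`. -/
def opL0 (Q r s : ℝ → ℂ) : L2 →ₗ.[ℂ] L2 :=
  (opL00 Q r s).closure

/-- The minimal operator `L₀⁺`, the closure of `L₀₀⁺`. -/
def opL0Plus (Q r s : ℝ → ℂ) : L2 →ₗ.[ℂ] L2 :=
  (opL00Plus Q r s).closure

/-- `[u,v](x) = u(x) conj (v^{1}(x)) - u^{[1]}(x) conj (v(x))`, where `u`, `v` stand for their
locally absolutely continuous representatives. -/
def bracket (Q r : ℝ → ℂ) (u v : L2) (x : ℝ) : ℂ :=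
  acRep u x * conj (quasiDeriv₁ (conjFun (G₂ Q r)) (acRep v) x)
    - quasiDeriv₁ (G₁ Q r) (acRep u) x * conj (acRep v x)

/-- `[u,v]_{-∞}^{∞} = lim_{x → ∞} [u,v](x) - lim_{x → -∞} [u,v](x)`. -/
def bracketTotal (Q r : ℝ → ℂ) (u v : L2) : ℂ :=
  limUnder atTop (bracket Q r u v) - limUnder atBot (bracket Q r u v)

/-- `g` is the weak (distributional) derivative of `u` on `ℝ`. -/
def IsWeakDeriv (u g : ℝ → ℂ) : Prop :=
  ∀ φ : ℝ → ℂ, ContDiff ℝ ∞ φ → HasCompactSupport φ →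
    ∫ x, u x * deriv φ x = -∫ x, g x * φ x

/-- `u ∈ W¹_{2,loc}(ℝ)`. -/
def MemW12Loc (u : ℝ → ℂ) : Prop :=
  MemLpLoc u 2 ∧ ∃ g : ℝ → ℂ, MemLpLoc g 2 ∧ IsWeakDeriv u g

/-- `u ∈ W¹_{2,comp}(ℝ)`: `u ∈ W¹₂(ℝ)` with compact (essential) support. -/
def MemW12Comp (u : ℝ → ℂ) : Prop :=
  (MemLp u 2 volume ∧ ∃ g : ℝ → ℂ, MemLp g 2 volume ∧ IsWeakDeriv u g) ∧
    ∃ K : Set ℝ, IsCompact K ∧ ∀ᵐ x : ℝ, x ∉ K → u x = 0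

end

end QuasiDiff

/-! The quasi-derivatives turn `l[u] = h` into a first order linear system for `(u, u^{[1]})` whose
coefficients `G₁`, `G₂`, `1`, `G₁G₂ - s` are locally integrable. Initial value problems are
therefore solvable on compact intervals (`exists_isSolOn`), and no smoothness of `Q`, `r`, `s` is
ever needed. Differentiating the bracket gives the Lagrange identity: the integral of `l[u] v̄ - u
conj(l⁺[v])` over an interval is the increment of `[u,v]` (`IsSolOn.integral_lagrange`).

The main point is `mem_graph_of_formal_adjoint`: a pair `(w, k)` with `(l[u], w) = (u, k)` for all
`u ∈ Dom(L₀₀)` lies in the graph of `L⁺`. On `[a, b]` take a solution `v` of `l⁺[v] = k`. If `f` is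
orthogonal to all solutions of `l⁺[φ] = 0` on `[a, b]`, the solution of `l[u] = f` with zero data at
`a` also has zero data at `b`, so its extension by zero is an admissible test element, and testing
gives `f ⊥ w - v`. Hence `w - v` lies in the two-dimensional space of homogeneous solutions, and `w`
solves `l⁺[w] = k` on `[a, b]`. Local representatives are then glued.

Density follows from this with `w = 0`. The adjoint formulas follow together with the Lagrange
identity, whose boundary terms vanish for compact support. Maximal operators are adjoints, hence
closed. The closure of `L₀₀` is its double adjoint `(L⁺)*`, and by the Lagrange identity on `ℝ`
membership in its domain means that `[u,v]` has equal limits at both ends. The quadratic form is one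
more integration by parts. -/

/-! ### Calculus of locally absolutely continuous complex functions. -/

/-- The composition of a Lipschitz map with an absolutely continuous function is absolutely
continuous. -/
theorem LipschitzOnWith.comp_absolutelyContinuousOnInterval {X Y : Type*} [PseudoMetricSpace X]
    [PseudoMetricSpace Y] {φ : X → Y} {K : NNReal} {t : Set X} {f : ℝ → X} {a b : ℝ}
    (hφ : LipschitzOnWith K φ t) (hf : AbsolutelyContinuousOnInterval f a b)
    (hmaps : MapsTo f (uIcc a b) t) : AbsolutelyContinuousOnInterval (fun x => φ (f x)) a b := by
  rw [absolutelyContinuousOnInterval_iff] at hf ⊢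
  intro ε hε
  obtain ⟨δ, hδ, h⟩ := hf (ε / (K + 1)) (by positivity)
  refine ⟨δ, hδ, fun E hE hlen => ?_⟩
  have h1 := h E hE hlen
  have h2 : ∑ i ∈ Finset.range E.1, dist (φ (f (E.2 i).1)) (φ (f (E.2 i).2))
      ≤ K * ∑ i ∈ Finset.range E.1, dist (f (E.2 i).1) (f (E.2 i).2) := by
    rw [Finset.mul_sum]
    refine Finset.sum_le_sum fun i hi => ?_
    have hm := hE.1 i hi
    exact hφ.dist_le_mul _ (hmaps hm.1) _ (hmaps hm.2)
  have h3 : (0 : ℝ) ≤ ∑ i ∈ Finset.range E.1, dist (f (E.2 i).1) (f (E.2 i).2) :=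
    Finset.sum_nonneg fun _ _ => dist_nonneg
  rw [lt_div_iff₀ (by positivity)] at h1
  nlinarith

theorem LipschitzWith.comp_absolutelyContinuousOnInterval {X Y : Type*} [PseudoMetricSpace X]
    [PseudoMetricSpace Y] {φ : X → Y} {K : NNReal} {f : ℝ → X} {a b : ℝ}
    (hφ : LipschitzWith K φ) (hf : AbsolutelyContinuousOnInterval f a b) :
    AbsolutelyContinuousOnInterval (fun x => φ (f x)) a b :=
  (hφ.lipschitzOnWith (s := univ)).comp_absolutelyContinuousOnInterval hf (mapsTo_univ _ _)

theorem IntervalIntegrable.complexOfReal {f : ℝ → ℝ} {a b : ℝ}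
    (hf : IntervalIntegrable f volume a b) :
    IntervalIntegrable (fun x => (f x : ℂ)) volume a b :=
  ⟨hf.1.ofReal, hf.2.ofReal⟩

namespace MeasureTheory

theorem LocallyIntegrable.intervalIntegrable {E : Type*} [NormedAddCommGroup E] {f : ℝ → E}
    (hf : LocallyIntegrable f volume) (a b : ℝ) : IntervalIntegrable f volume a b :=
  intervalIntegrable_iff.mpr <|
    (hf.integrableOn_isCompact isCompact_uIcc).mono_set uIoc_subset_uIcc

theorem locallyIntegrable_of_intervalIntegrable {E : Type*} [NormedAddCommGroup E] {f : ℝ → E}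
    (hf : ∀ a b, IntervalIntegrable f volume a b) : LocallyIntegrable f volume := by
  intro x
  refine ⟨Ioo (x - 1) (x + 1), Ioo_mem_nhds (by linarith) (by linarith), ?_⟩
  have h := (intervalIntegrable_iff_integrableOn_Ioc_of_le (by linarith)).1 (hf (x - 1) (x + 1))
  exact h.mono_set Ioo_subset_Ioc_self

end MeasureTheory

namespace QuasiDiff

theorem ACLoc.ofReal {f : ℝ → ℝ} (hf : ∀ a b, AbsolutelyContinuousOnInterval f a b) :
    ACLoc (fun x => (f x : ℂ)) :=
  fun a b => Complex.isometry_ofReal.lipschitz.comp_absolutelyContinuousOnInterval (hf a b)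

theorem ACLoc.re {u : ℝ → ℂ} (hu : ACLoc u) (a b : ℝ) :
    AbsolutelyContinuousOnInterval (fun x => (u x).re) a b :=
  Complex.reCLM.lipschitz.comp_absolutelyContinuousOnInterval (hu a b)

theorem ACLoc.im {u : ℝ → ℂ} (hu : ACLoc u) (a b : ℝ) :
    AbsolutelyContinuousOnInterval (fun x => (u x).im) a b :=
  Complex.imCLM.lipschitz.comp_absolutelyContinuousOnInterval (hu a b)

theorem ACLoc.conj {u : ℝ → ℂ} (hu : ACLoc u) : ACLoc (fun x => conj (u x)) :=
  fun a b => Complex.conjLIE.lipschitz.comp_absolutelyContinuousOnInterval (hu a b)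

theorem ACLoc.mul {u v : ℝ → ℂ} (hu : ACLoc u) (hv : ACLoc v) : ACLoc (fun x => u x * v x) :=
  fun a b => (hu a b).smul (hv a b)

theorem ACLoc.sub {u v : ℝ → ℂ} (hu : ACLoc u) (hv : ACLoc v) : ACLoc (fun x => u x - v x) :=
  fun a b => (hu a b).sub (hv a b)

theorem ACLoc.const (c : ℂ) : ACLoc (fun _ => c) :=
  fun _ _ => (contDiff_const.contDiffOn).absolutelyContinuousOnInterval

theorem ACLoc.of_contDiff {φ : ℝ → ℂ} (hφ : ContDiff ℝ 1 φ) : ACLoc φ :=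
  fun _ _ => hφ.contDiffOn.absolutelyContinuousOnInterval

theorem deriv_eq_re_add_im {u : ℝ → ℂ} {x : ℝ} (hu : DifferentiableAt ℝ u x) :
    deriv (fun x => (u x).re) x = (deriv u x).re ∧ deriv (fun x => (u x).im) x = (deriv u x).im :=
  ⟨(Complex.reCLM.hasFDerivAt.comp_hasDerivAt x hu.hasDerivAt).deriv,
    (Complex.imCLM.hasFDerivAt.comp_hasDerivAt x hu.hasDerivAt).deriv⟩

theorem ACLoc.deriv_ae_eq {u : ℝ → ℂ} (hu : ACLoc u) :
    deriv u =ᵐ[volume] fun x => ((deriv (fun x => (u x).re) x : ℝ) : ℂ)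
      + ((deriv (fun x => (u x).im) x : ℝ) : ℂ) * Complex.I := by
  filter_upwards [hu.ae_differentiableAt] with x hx
  rw [(deriv_eq_re_add_im hx).1, (deriv_eq_re_add_im hx).2, Complex.re_add_im]

theorem ACLoc.locallyIntegrable_deriv {u : ℝ → ℂ} (hu : ACLoc u) :
    LocallyIntegrable (deriv u) volume := by
  refine locallyIntegrable_of_intervalIntegrable fun a b => ?_
  have h1 : IntervalIntegrable (fun x => ((deriv (fun x => (u x).re) x : ℝ) : ℂ)) volume a b :=
    (hu.re a b).intervalIntegrable_deriv.complexOfReal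
  have h2 : IntervalIntegrable (fun x => ((deriv (fun x => (u x).im) x : ℝ) : ℂ)) volume a b :=
    (hu.im a b).intervalIntegrable_deriv.complexOfReal
  exact (h1.add (h2.mul_const Complex.I)).congr_ae (ae_restrict_of_ae hu.deriv_ae_eq.symm)

/-- The fundamental theorem of calculus for complex-valued locally absolutely continuous
functions. -/
theorem ACLoc.integral_deriv {u : ℝ → ℂ} (hu : ACLoc u) (a b : ℝ) :
    ∫ x in a..b, deriv u x = u b - u a := by
  have h1 : IntervalIntegrable (fun x => ((deriv (fun x => (u x).re) x : ℝ) : ℂ)) volume a b :=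
    (hu.re a b).intervalIntegrable_deriv.complexOfReal
  have h2 : IntervalIntegrable (fun x => ((deriv (fun x => (u x).im) x : ℝ) : ℂ)) volume a b :=
    (hu.im a b).intervalIntegrable_deriv.complexOfReal
  rw [intervalIntegral.integral_congr_ae (hu.deriv_ae_eq.mono fun x hx _ => hx),
    intervalIntegral.integral_add h1 (h2.mul_const Complex.I),
    intervalIntegral.integral_mul_const, intervalIntegral.integral_ofReal,
    intervalIntegral.integral_ofReal, (hu.re a b).integral_deriv_eq_sub,
    (hu.im a b).integral_deriv_eq_sub]
  apply Complex.ext <;> simp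

theorem ACLoc.of_integral {f : ℝ → ℂ} (hf : LocallyIntegrable f volume) (c : ℝ) :
    ACLoc (fun x => ∫ t in c..x, f t) := by
  have hre : ∀ a b, IntervalIntegrable (fun x => (f x).re) volume a b :=
    fun a b => ⟨(hf.intervalIntegrable a b).1.re, (hf.intervalIntegrable a b).2.re⟩
  have him : ∀ a b, IntervalIntegrable (fun x => (f x).im) volume a b :=
    fun a b => ⟨(hf.intervalIntegrable a b).1.im, (hf.intervalIntegrable a b).2.im⟩
  have key : ∀ g : ℝ → ℝ, (∀ a b, IntervalIntegrable g volume a b) →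
      ∀ a b, AbsolutelyContinuousOnInterval (fun x => ∫ t in c..x, g t) a b := by
    intro g hg a b
    -- The interval is enlarged to contain the base point `c` of the primitive, then cut back to
    -- `[a, b]`.
    have h := (hg (min c (min a b)) (max c (max a b))
      ).absolutelyContinuousOnInterval_intervalIntegral (c := c)
      (by rw [mem_uIcc]; left; exact ⟨min_le_left _ _, le_max_left _ _⟩)
    refine h.mono ?_
    rw [uIcc_of_le ((min_le_left _ _).trans (le_max_left c _))]
    exact Icc_subset_Icc (min_le_right _ _) (le_max_right _ _)
  have h := (ACLoc.ofReal (key _ hre)).add ((ACLoc.ofReal (key _ him)).mul (ACLoc.const Complex.I))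
  convert h using 1
  funext x
  simp only [Pi.add_apply]
  rw [← intervalIntegral.integral_ofReal, ← intervalIntegral.integral_ofReal,
    ← intervalIntegral.integral_mul_const, ← intervalIntegral.integral_add]
  · exact intervalIntegral.integral_congr fun t _ => (Complex.re_add_im _).symm
  · exact IntervalIntegrable.complexOfReal (hre c x)
  · exact (IntervalIntegrable.complexOfReal (him c x)).mul_const _

theorem deriv_integral_ae_eq {f : ℝ → ℂ} (hf : LocallyIntegrable f volume) (c : ℝ) :
    deriv (fun x => ∫ t in c..x, f t) =ᵐ[volume] f := by
  filter_upwards [_root_.LocallyIntegrable.ae_hasDerivAt_integral hf] with x hx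
  exact (hx c).deriv

/-- If `f` agrees a.e. on every bounded interval with some locally absolutely continuous
function, then it has a locally absolutely continuous representative. -/
theorem hasACRep_of_local {f : ℝ → ℂ}
    (h : ∀ n : ℕ, ∃ V : ℝ → ℂ, ACLoc V ∧ ∀ᵐ x : ℝ, x ∈ Icc (-(n : ℝ)) n → V x = f x) :
    HasACRep f := by
  choose V hV hVf using h
  have agree : ∀ m n : ℕ, m ≤ n → ∀ x ∈ Ioo (-(m : ℝ)) m, V m x = V n x := by
    intro m n hmn
    have hmn' : (m : ℝ) ≤ n := by exact_mod_cast hmn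
    have : V m =ᵐ[volume.restrict (Ioo (-(m : ℝ)) m)] V n := by
      rw [Filter.EventuallyEq, ae_restrict_iff' measurableSet_Ioo]
      filter_upwards [hVf m, hVf n] with x h1 h2 hx
      rw [h1 (Ioo_subset_Icc_self hx), h2 ⟨by linarith [hx.1], by linarith [hx.2]⟩]
    exact Measure.eqOn_open_of_ae_eq this isOpen_Ioo (hV m).continuous.continuousOn
      (hV n).continuous.continuousOn
  -- The `+ 1` puts `x` in the open interval, where the continuous representatives agree everywhere
  -- and not merely almost everywhere.
  let U : ℝ → ℂ := fun x => V (⌈|x|⌉₊ + 1) x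
  have hU : ∀ n : ℕ, ∀ x ∈ Ioo (-(n : ℝ)) n, U x = V n x := by
    intro n x hx
    have hx1 : |x| < ((⌈|x|⌉₊ + 1 : ℕ) : ℝ) := by
      push_cast
      linarith [Nat.le_ceil |x|]
    rcases le_total (⌈|x|⌉₊ + 1) n with hle | hle
    · exact agree _ _ hle x (abs_lt.1 hx1)
    · exact (agree _ _ hle x hx).symm
  refine ⟨U, fun a b => ?_, ?_⟩
  · obtain ⟨n, hn⟩ := exists_nat_gt (max |a| |b|)
    have hab : uIcc a b ⊆ Ioo (-(n : ℝ)) n :=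
      ordConnected_Ioo.uIcc_subset (abs_lt.1 ((le_max_left _ _).trans_lt hn))
        (abs_lt.1 ((le_max_right _ _).trans_lt hn))
    have hVn := hV n a b
    rw [absolutelyContinuousOnInterval_iff] at hVn ⊢
    intro ε hε
    obtain ⟨δ, hδ, hE⟩ := hVn ε hε
    refine ⟨δ, hδ, fun E hmem hlen => ?_⟩
    convert hE E hmem hlen using 1
    refine Finset.sum_congr rfl fun i hi => ?_
    have hm := hmem.1 i hi
    rw [hU n _ (hab hm.1), hU n _ (hab hm.2)]
  · have hall := ae_all_iff.2 hVf
    filter_upwards [hall] with x hx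
    have hx1 : |x| ≤ ((⌈|x|⌉₊ + 1 : ℕ) : ℝ) := by
      push_cast
      linarith [Nat.le_ceil |x|]
    exact hx _ (abs_le.1 hx1)

end QuasiDiff

/-! ### Linear initial value problems with integrable coefficients. -/

/-- The primitive of `k` is bounded on the interval and `exp` is Lipschitz on bounded sets, so the
exponential of the primitive is absolutely continuous and the fundamental theorem of calculus
applies. -/
theorem integral_mul_exp_integral {k : ℝ → ℝ} (hk : LocallyIntegrable k volume) (c x : ℝ) :
    ∫ t in c..x, k t * Real.exp (∫ τ in c..t, k τ) = Real.exp (∫ t in c..x, k t) - 1 := by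
  set m : ℝ → ℝ := fun x => ∫ t in c..x, k t with hm
  have hac : AbsolutelyContinuousOnInterval m c x :=
    (hk.intervalIntegrable c x).absolutelyContinuousOnInterval_intervalIntegral left_mem_uIcc
  have hcont : ContinuousOn m (uIcc c x) := hac.continuousOn
  obtain ⟨C, hC⟩ := hac.exists_bound
  obtain ⟨K, hK⟩ := Real.contDiff_exp.contDiffOn.exists_lipschitzOnWith (n := 1) one_ne_zero
    (convex_Icc (-C) C) isCompact_Icc
  have hE : AbsolutelyContinuousOnInterval (fun x => Real.exp (m x)) c x :=
    hK.comp_absolutelyContinuousOnInterval hac fun y hy => abs_le.1 (hC y hy)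
  have h := hE.integral_deriv_eq_sub
  have hmc : m c = 0 := by simp [hm]
  rw [hmc, Real.exp_zero] at h
  rw [← h]
  refine intervalIntegral.integral_congr_ae ?_
  filter_upwards [_root_.LocallyIntegrable.ae_hasDerivAt_integral hk] with t ht _
  rw [(ht c).exp.deriv, mul_comm]

/-- This makes the Picard map a contraction in a weighted norm: the 2 in the exponent becomes the
factor 1/2. The primitive has constant sign on each side of `c`, so the previous identity applies
with `2k` to the right and `-2k` to the left. -/
theorem abs_integral_mul_exp_abs_le {k : ℝ → ℝ} (hk : LocallyIntegrable k volume)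
    (h0 : ∀ t, 0 ≤ k t) (c x : ℝ) :
    |∫ t in c..x, k t * Real.exp (2 * |∫ τ in c..t, k τ|)| ≤
      Real.exp (2 * |∫ t in c..x, k t|) / 2 := by
  rcases le_total c x with hcx | hcx
  · have hpos : ∀ t ∈ uIcc c x, 0 ≤ ∫ τ in c..t, k τ := by
      intro t ht
      rw [uIcc_of_le hcx] at ht
      exact intervalIntegral.integral_nonneg ht.1 fun τ _ => h0 τ
    have h1 := integral_mul_exp_integral (hk.smul (2 : ℝ)) c x
    simp only [Pi.smul_apply, smul_eq_mul, intervalIntegral.integral_const_mul, mul_assoc] at h1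
    have h2 : ∫ t in c..x, k t * Real.exp (2 * |∫ τ in c..t, k τ|)
        = ∫ t in c..x, k t * Real.exp (2 * ∫ τ in c..t, k τ) :=
      intervalIntegral.integral_congr fun t ht => by
        simp only [abs_of_nonneg (hpos t ht)]
    have h3 : 0 ≤ ∫ t in c..x, k t * Real.exp (2 * |∫ τ in c..t, k τ|) :=
      intervalIntegral.integral_nonneg hcx fun t _ => mul_nonneg (h0 t) (Real.exp_pos _).le
    rw [abs_of_nonneg h3, abs_of_nonneg (hpos x right_mem_uIcc), h2]
    linarith
  · have hneg : ∀ t ∈ uIcc c x, ∫ τ in c..t, k τ ≤ 0 := by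
      intro t ht
      rw [uIcc_of_ge hcx] at ht
      rw [intervalIntegral.integral_symm, neg_nonpos]
      exact intervalIntegral.integral_nonneg ht.2 fun τ _ => h0 τ
    have h1 := integral_mul_exp_integral (hk.smul (-2 : ℝ)) c x
    simp only [Pi.smul_apply, smul_eq_mul, intervalIntegral.integral_const_mul, mul_assoc] at h1
    have h2 : ∫ t in c..x, k t * Real.exp (2 * |∫ τ in c..t, k τ|)
        = ∫ t in c..x, k t * Real.exp (-2 * ∫ τ in c..t, k τ) :=
      intervalIntegral.integral_congr fun t ht => by
        simp only [abs_of_nonpos (hneg t ht)]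
        congr 2
        ring
    have h3 : ∫ t in c..x, k t * Real.exp (2 * |∫ τ in c..t, k τ|) ≤ 0 := by
      rw [intervalIntegral.integral_symm, neg_nonpos]
      exact intervalIntegral.integral_nonneg hcx fun t _ => mul_nonneg (h0 t) (Real.exp_pos _).le
    rw [abs_of_nonpos h3, abs_of_nonpos (hneg x right_mem_uIcc), h2]
    have h4 : (2 : ℝ) * -(∫ t in c..x, k t) = -2 * ∫ t in c..x, k t := by ring
    rw [h4]
    linarith

section LinearIntegralEquation

variable {E : Type*} [NormedAddCommGroup E] [NormedSpace ℝ E]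

theorem MeasureTheory.Integrable.clm_apply_of_bound {B : ℝ → E →L[ℝ] E} (hB : Integrable B volume)
    {Z : ℝ → E} (hZ : Continuous Z) {C : ℝ} (hC : ∀ t, ‖Z t‖ ≤ C) :
    Integrable (fun t => B t (Z t)) volume := by
  refine (hB.norm.mul_const C).mono' ?_ (Eventually.of_forall fun t => ?_)
  · exact (ContinuousLinearMap.apply ℝ E).flip.aestronglyMeasurable_comp₂ hB.1
      hZ.aestronglyMeasurable
  · exact ((B t).le_opNorm _).trans (mul_le_mul_of_nonneg_left (hC t) (norm_nonneg _))

variable [CompleteSpace E]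

/-- Linear initial value problems with integrable coefficients are solvable in integral form. -/
theorem exists_continuous_eq_add_integral {B : ℝ → E →L[ℝ] E} {F : ℝ → E}
    (hB : Integrable B volume) (hF : Integrable F volume) (c : ℝ) (y₀ : E) :
    ∃ Y : ℝ → E, Continuous Y ∧ ∀ x, Y x = y₀ + ∫ t in c..x, (B t (Y t) + F t) := by
  set m : ℝ → ℝ := fun x => ∫ t in c..x, ‖B t‖ with hm
  have hmc : Continuous m :=
    intervalIntegral.continuous_primitive (fun a b => hB.norm.intervalIntegrable) c
  set M : ℝ := ∫ t, ‖B t‖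
  have hmM : ∀ x, |m x| ≤ M := fun x => by
    have h1 := intervalIntegral.norm_integral_le_integral_norm_uIoc (f := fun t => ‖B t‖)
      (a := c) (b := x) (μ := volume)
    simp only [Real.norm_eq_abs, abs_norm] at h1
    exact h1.trans (setIntegral_le_integral hB.norm (Eventually.of_forall fun _ => norm_nonneg _))
  -- Exponential weight for the solution. As `‖B‖` is integrable on all of `ℝ`, `W` lies between 1
  -- and `exp (2M)`, so one fixed point argument covers the whole line.
  set W : ℝ → ℝ := fun x => Real.exp (2 * |m x|) with hW
  have hWc : Continuous W := by fun_prop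
  have hW1 : ∀ x, 1 ≤ W x := fun x => Real.one_le_exp (by positivity)
  have hW0 : ∀ x, 0 < W x := fun x => Real.exp_pos _
  have hWM : ∀ x, W x ≤ Real.exp (2 * M) := fun x => Real.exp_le_exp.2 (by linarith [hmM x])
  have hint : ∀ Z : BoundedContinuousFunction ℝ E,
      Integrable (fun t => B t (W t • Z t)) volume := fun Z =>
    hB.clm_apply_of_bound (hWc.smul Z.continuous) (C := Real.exp (2 * M) * ‖Z‖) fun t => by
      rw [norm_smul, Real.norm_of_nonneg (hW0 t).le]
      exact mul_le_mul (hWM t) (Z.norm_coe_le_norm t) (norm_nonneg _) (Real.exp_pos _).le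
  have hadd : ∀ Z : BoundedContinuousFunction ℝ E,
      Integrable (fun t => B t (W t • Z t) + F t) volume := fun Z => (hint Z).add hF
  have hprim : ∀ Z : BoundedContinuousFunction ℝ E,
      Continuous fun x => ∫ t in c..x, (B t (W t • Z t) + F t) := fun Z =>
    intervalIntegral.continuous_primitive
      (fun a b => (hadd Z).intervalIntegrable) c
  -- The Picard map written for `Z = Y / W`; the ordinary sup norm of `Z` is the weighted norm of
  -- `Y`.
  let Φ : BoundedContinuousFunction ℝ E → BoundedContinuousFunction ℝ E := fun Z =>
    BoundedContinuousFunction.ofNormedAddCommGroup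
      (fun x => (W x)⁻¹ • (y₀ + ∫ t in c..x, (B t (W t • Z t) + F t)))
      ((hWc.inv₀ fun x => (hW0 x).ne').smul (continuous_const.add (hprim Z)))
      (‖y₀‖ + ∫ t, ‖B t (W t • Z t) + F t‖) (fun x => by
        rw [norm_smul, norm_inv, Real.norm_of_nonneg (hW0 x).le]
        have h1 : ‖y₀ + ∫ t in c..x, (B t (W t • Z t) + F t)‖
            ≤ ‖y₀‖ + ∫ t, ‖B t (W t • Z t) + F t‖ := by
          refine (norm_add_le _ _).trans (add_le_add_right ?_ _)
          refine intervalIntegral.norm_integral_le_integral_norm_uIoc.trans ?_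
          exact setIntegral_le_integral (hadd Z).norm
            (Eventually.of_forall fun _ => norm_nonneg _)
        calc (W x)⁻¹ * ‖y₀ + ∫ t in c..x, (B t (W t • Z t) + F t)‖
            ≤ 1 * ‖y₀ + ∫ t in c..x, (B t (W t • Z t) + F t)‖ :=
              mul_le_mul_of_nonneg_right (inv_le_one_of_one_le₀ (hW1 x)) (norm_nonneg _)
          _ ≤ _ := by rwa [one_mul])
  have hΦ : ∀ Z x, Φ Z x = (W x)⁻¹ • (y₀ + ∫ t in c..x, (B t (W t • Z t) + F t)) :=
    fun _ _ => rfl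
  have hcontr : ContractingWith (1 / 2) Φ := by
    refine ⟨by rw [← NNReal.coe_lt_coe]; norm_num, LipschitzWith.of_dist_le_mul fun Z Z' => ?_⟩
    rw [BoundedContinuousFunction.dist_le (by positivity)]
    intro x
    rw [hΦ, hΦ, dist_eq_norm, ← smul_sub, add_sub_add_left_eq_sub,
      ← intervalIntegral.integral_sub (hadd Z).intervalIntegrable
        (hadd Z').intervalIntegrable, norm_smul, norm_inv,
      Real.norm_of_nonneg (hW0 x).le]
    have h1 : ‖∫ t in c..x, (B t (W t • Z t) + F t - (B t (W t • Z' t) + F t))‖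
        ≤ |∫ t in c..x, ‖B t‖ * W t * dist Z Z'| := by
      refine intervalIntegral.norm_integral_le_abs_of_norm_le
        (Eventually.of_forall fun t => ?_) ?_
      · rw [add_sub_add_right_eq_sub, ← map_sub, ← smul_sub, mul_assoc]
        refine ((B t).le_opNorm _).trans (mul_le_mul_of_nonneg_left ?_ (norm_nonneg _))
        rw [norm_smul, Real.norm_of_nonneg (hW0 t).le, ← dist_eq_norm]
        exact mul_le_mul_of_nonneg_left (BoundedContinuousFunction.dist_coe_le_dist t) (hW0 t).le
      · exact ((hB.norm.locallyIntegrable.intervalIntegrable c x).mul_continuousOn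
          hWc.continuousOn).mul_const _
    rw [intervalIntegral.integral_mul_const, abs_mul, abs_of_nonneg dist_nonneg] at h1
    have h2 := abs_integral_mul_exp_abs_le hB.norm.locallyIntegrable (fun t => norm_nonneg _) c x
    have h3 := h1.trans (mul_le_mul_of_nonneg_right h2 dist_nonneg)
    calc (W x)⁻¹ * ‖∫ t in c..x, (B t (W t • Z t) + F t - (B t (W t • Z' t) + F t))‖
        ≤ (W x)⁻¹ * (W x / 2 * dist Z Z') :=
          mul_le_mul_of_nonneg_left h3 (inv_nonneg.2 (hW0 x).le)
      _ = ((1 / 2 : NNReal) : ℝ) * dist Z Z' := by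
          have := (hW0 x).ne'
          push_cast
          field_simp
  obtain ⟨Z, hZ⟩ : ∃ Z, Φ Z = Z := ⟨_, hcontr.fixedPoint_isFixedPt⟩
  refine ⟨fun x => W x • Z x, hWc.smul Z.continuous, fun x => ?_⟩
  have h := hΦ Z x
  rw [hZ] at h
  simp only
  rw [h, smul_inv_smul₀ (hW0 x).ne']

end LinearIntegralEquation

namespace QuasiDiff

/-! ### Local integrability -/

theorem MemLpLoc.locallyIntegrable {f : ℝ → ℂ} {p : ENNReal} (hf : MemLpLoc f p) (hp : 1 ≤ p) :
    LocallyIntegrable f volume := by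
  refine locallyIntegrable_iff.2 fun K hK => ?_
  have : IsFiniteMeasure (volume.restrict K) := ⟨by simpa using hK.measure_lt_top⟩
  exact (hf K hK).integrable hp

theorem MemLpLoc.mul {f g : ℝ → ℂ} (hf : MemLpLoc f 2) (hg : MemLpLoc g 2) :
    MemLpLoc (fun x => f x * g x) 1 := fun K hK =>
  memLp_one_iff_integrable.2 ((hf K hK).integrable_mul (hg K hK))

theorem MemLpLoc.add {f g : ℝ → ℂ} {p : ENNReal} (hf : MemLpLoc f p) (hg : MemLpLoc g p) :
    MemLpLoc (fun x => f x + g x) p := fun K hK => (hf K hK).add (hg K hK)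

theorem MemLpLoc.sub {f g : ℝ → ℂ} {p : ENNReal} (hf : MemLpLoc f p) (hg : MemLpLoc g p) :
    MemLpLoc (fun x => f x - g x) p := fun K hK => (hf K hK).sub (hg K hK)

theorem MemLpLoc.const_mul {f : ℝ → ℂ} {p : ENNReal} (hf : MemLpLoc f p) (c : ℂ) :
    MemLpLoc (fun x => c * f x) p := fun K hK => (hf K hK).const_mul c

theorem MemLpLoc.conj {f : ℝ → ℂ} {p : ENNReal} (hf : MemLpLoc f p) :
    MemLpLoc (conjFun f) p := fun K hK => (hf K hK).star

theorem MemLpLoc.congr {f g : ℝ → ℂ} {p : ENNReal} (hf : MemLpLoc f p) (h : f =ᵐ[volume] g) :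
    MemLpLoc g p := fun K hK => (hf K hK).ae_eq (ae_restrict_of_ae h)

theorem MemLpLoc.of_continuous {f : ℝ → ℂ} (hf : Continuous f) (p : ENNReal) : MemLpLoc f p := by
  intro K hK
  have : IsFiniteMeasure (volume.restrict K) := ⟨by simpa using hK.measure_lt_top⟩
  obtain ⟨C, hC⟩ := hK.exists_bound_of_continuousOn hf.continuousOn
  exact MemLp.of_bound hf.aestronglyMeasurable C
    ((ae_restrict_iff' hK.measurableSet).2 (Eventually.of_forall hC))

theorem MemLpLoc.mul_continuous {f g : ℝ → ℂ} {p : ENNReal} (hf : MemLpLoc f p)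
    (hg : Continuous g) : MemLpLoc (fun x => f x * g x) p := by
  intro K hK
  exact (MemLpLoc.of_continuous hg ⊤ K hK).mul (hf K hK)

@[simp]
theorem conjFun_conjFun (f : ℝ → ℂ) : conjFun (conjFun f) = f := by
  funext x
  simp [conjFun]

/-! ### Solutions of the quasi-differential system -/

/-- `u`, `u₁` are locally absolutely continuous, and on `S` the function `u₁` is the first
quasi-derivative of `u` and `l[u] = h`. -/
structure IsSolOn (g₁ g₂ s : ℝ → ℂ) (S : Set ℝ) (u u₁ h : ℝ → ℂ) : Prop where
  ac : ACLoc u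
  ac₁ : ACLoc u₁
  deriv_eq : ∀ᵐ x : ℝ, x ∈ S → deriv u x = u₁ x + g₁ x * u x
  deriv₁_eq : ∀ᵐ x : ℝ, x ∈ S →
    deriv u₁ x = -h x - g₂ x * u₁ x - (g₁ x * g₂ x - s x) * u x

theorem IsSolOn.congr {g₁ g₂ s u u₁ h k : ℝ → ℂ} {S : Set ℝ} (hu : IsSolOn g₁ g₂ s S u u₁ h)
    (hk : ∀ᵐ x : ℝ, x ∈ S → h x = k x) : IsSolOn g₁ g₂ s S u u₁ k :=
  ⟨hu.ac, hu.ac₁, hu.deriv_eq, by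
    filter_upwards [hu.deriv₁_eq, hk] with x h1 h2 hS
    rw [h1 hS, h2 hS]⟩

/-- Linear combinations of solutions. -/
theorem IsSolOn.add_const_mul {g₁ g₂ s u u₁ h v v₁ k : ℝ → ℂ} {S : Set ℝ}
    (hu : IsSolOn g₁ g₂ s S u u₁ h) (hv : IsSolOn g₁ g₂ s S v v₁ k) (c : ℂ) :
    IsSolOn g₁ g₂ s S (u + c • v) (u₁ + c • v₁) (h + c • k) := by
  refine ⟨hu.ac.add (hv.ac.smul c), hu.ac₁.add (hv.ac₁.smul c), ?_, ?_⟩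
  · filter_upwards [hu.deriv_eq, hv.deriv_eq, hu.ac.ae_differentiableAt,
      hv.ac.ae_differentiableAt] with x h1 h2 h3 h4 hS
    rw [deriv_add h3 (h4.const_smul c), deriv_const_smul c h4, h1 hS, h2 hS]
    simp only [Pi.add_apply, Pi.smul_apply, smul_eq_mul]
    ring
  · filter_upwards [hu.deriv₁_eq, hv.deriv₁_eq, hu.ac₁.ae_differentiableAt,
      hv.ac₁.ae_differentiableAt] with x h1 h2 h3 h4 hS
    rw [deriv_add h3 (h4.const_smul c), deriv_const_smul c h4, h1 hS, h2 hS]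
    simp only [Pi.add_apply, Pi.smul_apply, smul_eq_mul]
    ring

/-- The equation is a first order system in `ℂ × ℂ` for `(u, u₁)`. Cutting the coefficients off
outside `[a, b]` makes them integrable on `ℝ`, at the price that the equations hold only on `[a,
b]`. -/
theorem exists_isSolOn {g₁ g₂ s h : ℝ → ℂ} (hg₁ : MemLpLoc g₁ 2) (hg₂ : MemLpLoc g₂ 2)
    (hs : MemLpLoc s 1) (hh : LocallyIntegrable h volume) (a b c : ℝ) (y₀ y₁ : ℂ) :
    ∃ u u₁, IsSolOn g₁ g₂ s (Icc a b) u u₁ h ∧ u c = y₀ ∧ u₁ c = y₁ := by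
  have trunc : ∀ {f : ℝ → ℂ}, LocallyIntegrable f volume →
      Integrable ((Icc a b).indicator f) volume := fun hf =>
    (integrable_indicator_iff measurableSet_Icc).2 (hf.integrableOn_isCompact isCompact_Icc)
  let i₁ : ℂ →L[ℝ] ℂ × ℂ := ContinuousLinearMap.inl ℝ ℂ ℂ
  let i₂ : ℂ →L[ℝ] ℂ × ℂ := ContinuousLinearMap.inr ℝ ℂ ℂ
  let π₁ : ℂ × ℂ →L[ℝ] ℂ := ContinuousLinearMap.fst ℝ ℂ ℂ
  let π₂ : ℂ × ℂ →L[ℝ] ℂ := ContinuousLinearMap.snd ℝ ℂ ℂ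
  let k₁₂ : ℝ → ℂ := (Icc a b).indicator fun _ => 1
  let k₁₁ : ℝ → ℂ := (Icc a b).indicator g₁
  let k₂₂ : ℝ → ℂ := (Icc a b).indicator g₂
  let k₂₁ : ℝ → ℂ := (Icc a b).indicator fun x => g₁ x * g₂ x - s x
  have h₁₁ : Integrable k₁₁ volume := trunc (hg₁.locallyIntegrable one_le_two)
  have h₂₂ : Integrable k₂₂ volume := trunc (hg₂.locallyIntegrable one_le_two)
  have h₂₁ : Integrable k₂₁ volume := trunc (((hg₁.mul hg₂).sub hs).locallyIntegrable le_rfl)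
  have h₁₂ : Integrable k₁₂ volume := trunc (locallyIntegrable_const 1)
  have hhI : Integrable ((Icc a b).indicator h) volume := trunc hh
  let B : ℝ → (ℂ × ℂ →L[ℝ] ℂ × ℂ) := fun x =>
    k₁₁ x • i₁.comp π₁ + k₁₂ x • i₁.comp π₂ - k₂₁ x • i₂.comp π₁ - k₂₂ x • i₂.comp π₂
  have hB : Integrable B volume :=
    (((h₁₁.smul_const (i₁.comp π₁)).add (h₁₂.smul_const (i₁.comp π₂))).sub
      (h₂₁.smul_const (i₂.comp π₁))).sub (h₂₂.smul_const (i₂.comp π₂))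
  have hF : Integrable (fun x => i₂ (-(Icc a b).indicator h x)) volume :=
    i₂.integrable_comp hhI.neg
  obtain ⟨Y, hYc, hY⟩ := exists_continuous_eq_add_integral hB hF c (y₀, y₁)
  have hloc : LocallyIntegrable (fun t => B t (Y t) + i₂ (-(Icc a b).indicator h t)) volume := by
    refine LocallyIntegrable.add ?_ hF.locallyIntegrable
    refine locallyIntegrable_iff.2 fun K hK => ?_
    obtain ⟨C, hC⟩ := hK.exists_bound_of_continuousOn hYc.continuousOn
    refine (hB.norm.mul_const C).integrableOn.mono' ?_
      ((ae_restrict_iff' hK.measurableSet).2 (Eventually.of_forall fun t ht => ?_))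
    · exact ((ContinuousLinearMap.apply ℝ (ℂ × ℂ)).flip.aestronglyMeasurable_comp₂ hB.1
        hYc.aestronglyMeasurable).restrict
    · exact ((B t).le_opNorm _).trans (mul_le_mul_of_nonneg_left (hC t ht) (norm_nonneg _))
  have hloc₁ : LocallyIntegrable
      (fun t => (B t (Y t) + i₂ (-(Icc a b).indicator h t)).1) volume :=
    locallyIntegrable_iff.2 fun K hK => π₁.integrable_comp (hloc.integrableOn_isCompact hK)
  have hloc₂ : LocallyIntegrable
      (fun t => (B t (Y t) + i₂ (-(Icc a b).indicator h t)).2) volume :=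
    locallyIntegrable_iff.2 fun K hK => π₂.integrable_comp (hloc.integrableOn_isCompact hK)
  have e₁ : (fun x => (Y x).1) = fun x =>
      y₀ + ∫ t in c..x, (B t (Y t) + i₂ (-(Icc a b).indicator h t)).1 := by
    funext x
    have h1 := π₁.intervalIntegral_comp_comm (hloc.intervalIntegrable c x)
    rw [hY x]
    exact congrArg (fun z => y₀ + z) h1.symm
  have e₂ : (fun x => (Y x).2) = fun x =>
      y₁ + ∫ t in c..x, (B t (Y t) + i₂ (-(Icc a b).indicator h t)).2 := by
    funext x
    have h1 := π₂.intervalIntegral_comp_comm (hloc.intervalIntegrable c x)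
    rw [hY x]
    exact congrArg (fun z => y₁ + z) h1.symm
  refine ⟨fun x => (Y x).1, fun x => (Y x).2, ⟨?_, ?_, ?_, ?_⟩, ?_, ?_⟩
  · rw [e₁]
    exact (ACLoc.const y₀).add (ACLoc.of_integral hloc₁ c)
  · rw [e₂]
    exact (ACLoc.const y₁).add (ACLoc.of_integral hloc₂ c)
  · filter_upwards [deriv_integral_ae_eq hloc₁ c] with x hx hS
    rw [e₁, deriv_const_add, hx]
    simp [B, i₁, i₂, π₁, π₂, k₁₁, k₁₂, k₂₁, k₂₂, hS, add_comm]
  · filter_upwards [deriv_integral_ae_eq hloc₂ c] with x hx hS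
    rw [e₂, deriv_const_add, hx]
    simp [B, i₁, i₂, π₁, π₂, k₁₁, k₁₂, k₂₁, k₂₂, hS]
    ring
  · simp [hY c]
  · simp [hY c]

/-- The Lagrange identity on an interval. -/
theorem IsSolOn.integral_lagrange {g₁ g₂ s u u₁ h v v₁ k : ℝ → ℂ} {S : Set ℝ}
    (hu : IsSolOn g₁ g₂ s S u u₁ h)
    (hv : IsSolOn (conjFun g₂) (conjFun g₁) (conjFun s) S v v₁ k) {a b : ℝ}
    (hab : uIoc a b ⊆ S) :
    ∫ x in a..b, (h x * conj (v x) - u x * conj (k x)) =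
      (u b * conj (v₁ b) - u₁ b * conj (v b)) - (u a * conj (v₁ a) - u₁ a * conj (v a)) := by
  have hac := (hu.ac.mul hv.ac₁.conj).sub (hu.ac₁.mul hv.ac.conj)
  rw [← hac.integral_deriv a b]
  refine intervalIntegral.integral_congr_ae ?_
  filter_upwards [hu.deriv_eq, hu.deriv₁_eq, hv.deriv_eq, hv.deriv₁_eq, hu.ac.ae_differentiableAt,
    hu.ac₁.ae_differentiableAt, hv.ac.ae_differentiableAt, hv.ac₁.ae_differentiableAt]
    with x h1 h2 h3 h4 d1 d2 d3 d4 hx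
  have hS := hab hx
  have c3 : HasDerivAt (fun x => conj (v x)) (conj (deriv v x)) x := d3.hasDerivAt.star
  have c4 : HasDerivAt (fun x => conj (v₁ x)) (conj (deriv v₁ x)) x := d4.hasDerivAt.star
  have hd : HasDerivAt (fun x => u x * conj (v₁ x) - u₁ x * conj (v x)) _ x :=
    (d1.hasDerivAt.mul c4).sub (d2.hasDerivAt.mul c3)
  rw [hd.deriv, h1 hS, h2 hS, h3 hS, h4 hS]
  simp only [conjFun, map_add, map_sub, map_mul, map_neg, Complex.conj_conj]
  ring

/-- A locally absolutely continuous function that vanishes at the end points of an interval may be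
extended by zero. -/
theorem ACLoc.indicator_Icc {u : ℝ → ℂ} (hu : ACLoc u) {a b : ℝ} (hab : a ≤ b) (ha : u a = 0)
    (hb : u b = 0) : ACLoc ((Icc a b).indicator u) ∧
      deriv ((Icc a b).indicator u) =ᵐ[volume] (Icc a b).indicator (deriv u) := by
  have hI : Integrable ((Icc a b).indicator (deriv u)) volume :=
    (integrable_indicator_iff measurableSet_Icc).2
      (hu.locallyIntegrable_deriv.integrableOn_isCompact isCompact_Icc)
  -- The truncation is the primitive of the truncated derivative: nothing accumulates left of `a`,
  -- and right of `b` the integral stays at `u b = 0`.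
  have e : (Icc a b).indicator u = fun x => ∫ t in a..x, (Icc a b).indicator (deriv u) t := by
    have hin : ∀ x ∈ Icc a b, ∫ t in a..x, (Icc a b).indicator (deriv u) t = u x := by
      intro x hx
      rw [← sub_zero (u x), ← ha, ← hu.integral_deriv a x]
      refine intervalIntegral.integral_congr fun t ht => ?_
      rw [uIcc_of_le hx.1] at ht
      exact indicator_of_mem (show t ∈ Icc a b from ⟨ht.1, ht.2.trans hx.2⟩) _
    funext x
    by_cases hx : x ∈ Icc a b
    · rw [indicator_of_mem hx, hin x hx]
    · rw [indicator_of_notMem hx]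
      rcases lt_or_ge x a with hxa | hxa
      · rw [intervalIntegral.integral_symm, intervalIntegral.integral_of_le hxa.le,
          integral_Ioc_eq_integral_Ioo, setIntegral_eq_zero_of_forall_eq_zero, neg_zero]
        intro t ht
        exact indicator_of_notMem (fun h => not_le.2 ht.2 h.1) _
      · have hxb : b < x := not_le.1 fun h => hx ⟨hxa, h⟩
        rw [← intervalIntegral.integral_add_adjacent_intervals
          (hI.intervalIntegrable (a := a) (b := b)) (hI.intervalIntegrable (a := b) (b := x)),
          hin b ⟨hab, le_rfl⟩, hb, intervalIntegral.integral_of_le hxb.le,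
          setIntegral_eq_zero_of_forall_eq_zero, zero_add]
        intro t ht
        exact indicator_of_notMem (fun h => not_le.2 ht.1 h.2) _
  rw [e]
  exact ⟨ACLoc.of_integral hI.locallyIntegrable a, deriv_integral_ae_eq hI.locallyIntegrable a⟩

theorem IsSolOn.indicator {g₁ g₂ s u u₁ h : ℝ → ℂ} {a b : ℝ} (hab : a ≤ b)
    (hu : IsSolOn g₁ g₂ s (Icc a b) u u₁ h) (ha : u a = 0) (hb : u b = 0) (ha₁ : u₁ a = 0)
    (hb₁ : u₁ b = 0) : IsSolOn g₁ g₂ s univ ((Icc a b).indicator u) ((Icc a b).indicator u₁)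
      ((Icc a b).indicator h) := by
  obtain ⟨h1, h2⟩ := hu.ac.indicator_Icc hab ha hb
  obtain ⟨h3, h4⟩ := hu.ac₁.indicator_Icc hab ha₁ hb₁
  refine ⟨h1, h3, ?_, ?_⟩
  · filter_upwards [h2, hu.deriv_eq] with x e1 e2 _
    rw [e1]
    by_cases hx : x ∈ Icc a b
    · simp only [indicator_of_mem hx, e2 hx]
    · simp [indicator_of_notMem hx]
  · filter_upwards [h4, hu.deriv₁_eq] with x e1 e2 _
    rw [e1]
    by_cases hx : x ∈ Icc a b
    · simp only [indicator_of_mem hx, e2 hx]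
    · simp [indicator_of_notMem hx]

/-! ### The graph of the maximal operator -/

theorem IsSolOn.preQuasiDeriv_ae_eq {g₁ g₂ s u u₁ h : ℝ → ℂ} (hu : IsSolOn g₁ g₂ s univ u u₁ h) :
    u₁ =ᵐ[volume] preQuasiDeriv g₁ u := by
  filter_upwards [hu.deriv_eq] with x hx
  rw [preQuasiDeriv, hx (mem_univ x)]
  ring

theorem IsSolOn.quasiDeriv₁_eq {g₁ g₂ s u u₁ h : ℝ → ℂ} (hu : IsSolOn g₁ g₂ s univ u u₁ h) :
    quasiDeriv₁ g₁ u = u₁ :=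
  QuasiDiff.acRep_eq hu.ac₁ hu.preQuasiDeriv_ae_eq

theorem IsSolOn.quasiExpr_ae_eq {g₁ g₂ s u u₁ h : ℝ → ℂ} (hu : IsSolOn g₁ g₂ s univ u u₁ h) :
    quasiExpr g₁ g₂ s u =ᵐ[volume] h := by
  filter_upwards [hu.deriv₁_eq] with x hx
  simp only [quasiExpr, quasiDeriv₂, hu.quasiDeriv₁_eq, hx (mem_univ x)]
  ring

theorem isSolOn_of_mem_domain {g₁ g₂ s : ℝ → ℂ} (f : (maxOp g₁ g₂ s).domain) :
    IsSolOn g₁ g₂ s univ (acRep (f : L2)) (quasiDeriv₁ g₁ (acRep (f : L2)))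
      (maxOp g₁ g₂ s f : L2) := by
  obtain ⟨f, hf, hf1, hf2⟩ := f
  have hE : (maxOp g₁ g₂ s ⟨f, hf, hf1, hf2⟩ : L2) =ᵐ[volume] quasiExpr g₁ g₂ s (acRep f) :=
    hf2.coeFn_toLp
  refine ⟨(acRep_spec hf).1, (acRep_spec hf1).1, ?_, ?_⟩
  · filter_upwards [(acRep_spec hf1).2] with x hx _
    have hx' : quasiDeriv₁ g₁ (acRep f) x = _ := hx
    rw [hx', preQuasiDeriv]
    ring
  · filter_upwards [hE] with x hx _
    rw [hx, quasiExpr, quasiDeriv₂]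
    ring

theorem acRep_ae_eq {g₁ g₂ s : ℝ → ℂ} (f : (maxOp g₁ g₂ s).domain) :
    acRep (f : L2) =ᵐ[volume] (f : L2) := (acRep_spec f.2.1).2

/-- Converse of `isSolOn_of_mem_domain`. Uniqueness of continuous representatives identifies `u` and
`u₁` with the chosen representatives in the definition of `maxOp`. -/
theorem IsSolOn.mem_graph {g₁ g₂ s u u₁ : ℝ → ℂ} {f h : L2} (hu : IsSolOn g₁ g₂ s univ u u₁ h)
    (hf : u =ᵐ[volume] f) : (f, h) ∈ (maxOp g₁ g₂ s).graph := by
  have e : acRep f = u := acRep_eq hu.ac hf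
  have hmem : f ∈ (maxOp g₁ g₂ s).domain := by
    refine ⟨⟨u, hu.ac, hf⟩, ?_, ?_⟩
    · rw [e]
      exact ⟨u₁, hu.ac₁, hu.preQuasiDeriv_ae_eq⟩
    · rw [e]
      exact (memLp_congr_ae hu.quasiExpr_ae_eq).2 (Lp.memLp h)
  rw [LinearPMap.mem_graph_iff]
  refine ⟨⟨f, hmem⟩, rfl, ?_⟩
  apply Lp.ext
  refine EventuallyEq.trans (MemLp.coeFn_toLp hmem.2.2) ?_
  simp only [e]
  exact hu.quasiExpr_ae_eq

end QuasiDiff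

namespace QuasiDiff

/-! ### Truncation to a compact interval in `L²(ℝ)` -/

theorem memLp_indicator_Icc {φ : ℝ → ℂ} (hφ : Continuous φ) (a b : ℝ) :
    MemLp ((Icc a b).indicator φ) 2 volume :=
  (memLp_indicator_iff_restrict measurableSet_Icc).2
    (MemLpLoc.of_continuous hφ 2 (Icc a b) isCompact_Icc)

/-- Fixes the convention: the product `(g, f)`, linear in `g`, is `⟪f, g⟫_ℂ`. -/
theorem inner_eq_integral (f g : L2) : ⟪f, g⟫_ℂ = ∫ x, g x * conj (f x) := by
  simp only [L2.inner_def, RCLike.inner_apply]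

theorem integrable_mul_conj (f g : L2) : Integrable (fun x => g x * conj (f x)) volume := by
  simpa only [RCLike.inner_apply] using L2.integrable_inner (𝕜 := ℂ) f g

theorem inner_indicator_left {F : L2} {φ : ℝ → ℂ} {a b : ℝ} (hab : a ≤ b)
    (hF : F =ᵐ[volume] (Icc a b).indicator φ) (f : L2) :
    ⟪F, f⟫_ℂ = ∫ x in a..b, f x * conj (φ x) := by
  rw [inner_eq_integral, intervalIntegral.integral_of_le hab, ← integral_Icc_eq_integral_Ioc,
    ← integral_indicator measurableSet_Icc]
  refine integral_congr_ae ?_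
  filter_upwards [hF] with x hx
  rw [hx]
  by_cases hS : x ∈ Icc a b
  · simp only [indicator_of_mem hS]
  · simp [indicator_of_notMem hS]

theorem inner_indicator_right {F : L2} {φ : ℝ → ℂ} {a b : ℝ} (hab : a ≤ b)
    (hF : F =ᵐ[volume] (Icc a b).indicator φ) (f : L2) :
    ⟪f, F⟫_ℂ = ∫ x in a..b, φ x * conj (f x) := by
  rw [inner_eq_integral, intervalIntegral.integral_of_le hab, ← integral_Icc_eq_integral_Ioc,
    ← integral_indicator measurableSet_Icc]
  refine integral_congr_ae ?_
  filter_upwards [hF] with x hx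
  rw [hx]
  by_cases hS : x ∈ Icc a b
  · simp only [indicator_of_mem hS]
  · simp [indicator_of_notMem hS]

theorem L2.locallyIntegrable (f : L2) : LocallyIntegrable f volume :=
  (Lp.memLp f).locallyIntegrable one_le_two

/-! ### The pre-minimal operator -/

theorem mem_graph_domRestrict_iff {T : L2 →ₗ.[ℂ] L2} {S : Submodule ℂ L2} {f h : L2} :
    (f, h) ∈ (T.domRestrict S).graph ↔ f ∈ S ∧ (f, h) ∈ T.graph := by
  simp only [LinearPMap.mem_graph_iff]
  constructor
  · rintro ⟨⟨y, hy⟩, rfl, rfl⟩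
    exact ⟨hy.1, ⟨y, hy.2⟩, rfl, (LinearPMap.domRestrict_apply rfl).symm⟩
  · rintro ⟨hf, ⟨y, hy⟩, rfl, rfl⟩
    exact ⟨⟨y, hf, hy⟩, rfl, LinearPMap.domRestrict_apply rfl⟩

variable {g₁ g₂ s : ℝ → ℂ}

/-- If `l[u] = f` on `[a, b]` and `u`, `u^{[1]}` vanish at `a` and `b`, then the extension of `u`
by zero belongs to the domain of the pre-minimal operator. -/
theorem IsSolOn.mem_graph_domRestrict {u u₁ : ℝ → ℂ} {f U F : L2} {a b : ℝ} (hab : a ≤ b)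
    (hu : IsSolOn g₁ g₂ s (Icc a b) u u₁ f) (ha : u a = 0) (hb : u b = 0) (ha₁ : u₁ a = 0)
    (hb₁ : u₁ b = 0) (hU : U =ᵐ[volume] (Icc a b).indicator u)
    (hF : F =ᵐ[volume] (Icc a b).indicator f) :
    (U, F) ∈ ((maxOp g₁ g₂ s).domRestrict compactSupp).graph := by
  refine mem_graph_domRestrict_iff.2 ⟨⟨Icc a b, isCompact_Icc, ?_⟩, ?_⟩
  · filter_upwards [hU] with x hx hS
    rw [hx, indicator_of_notMem hS]
  · exact ((hu.indicator hab ha hb ha₁ hb₁).congr (hF.symm.mono fun x hx _ => hx)).mem_graph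
      hU.symm

/-- If `(l[u], w) = (u, k)` for all `u` in the domain of the pre-minimal operator, then on each
compact interval `w` is a solution of `l⁺[w] = k`. -/
theorem exists_isSolOn_of_formal_adjoint (hg₁ : MemLpLoc g₁ 2) (hg₂ : MemLpLoc g₂ 2)
    (hs : MemLpLoc s 1) {w k : L2}
    (H : ∀ f h : L2, (f, h) ∈ ((maxOp g₁ g₂ s).domRestrict compactSupp).graph →
      ⟪w, h⟫_ℂ = ⟪k, f⟫_ℂ) {a b : ℝ} (hab : a ≤ b) :
    ∃ V V₁, IsSolOn (conjFun g₂) (conjFun g₁) (conjFun s) (Icc a b) V V₁ k ∧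
      ∀ᵐ x : ℝ, x ∈ Icc a b → V x = w x := by
  -- `φ` and `ψ` form a basis of the homogeneous adjoint solutions, normalised at `b` so that
  -- `[u,φ](b) = u b` and `[u,ψ](b) = -u₁ b`.
  obtain ⟨φ, φ₁, hφ, hφb, hφ₁b⟩ := exists_isSolOn hg₂.conj hg₁.conj hs.conj
    (locallyIntegrable_zero : LocallyIntegrable (0 : ℝ → ℂ) volume) a b b 0 1
  obtain ⟨ψ, ψ₁, hψ, hψb, hψ₁b⟩ := exists_isSolOn hg₂.conj hg₁.conj hs.conj
    (locallyIntegrable_zero : LocallyIntegrable (0 : ℝ → ℂ) volume) a b b 1 0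
  obtain ⟨v, v₁, hv, -, -⟩ := exists_isSolOn hg₂.conj hg₁.conj hs.conj
    (L2.locallyIntegrable k) a b a 0 0
  have hEφ := (memLp_indicator_Icc hφ.ac.continuous a b).coeFn_toLp
  have hEψ := (memLp_indicator_Icc hψ.ac.continuous a b).coeFn_toLp
  have hEv := (memLp_indicator_Icc hv.ac.continuous a b).coeFn_toLp
  have hEw := ((Lp.memLp w).indicator (measurableSet_Icc (a := a) (b := b))).coeFn_toLp
  set Eφ : L2 := (memLp_indicator_Icc hφ.ac.continuous a b).toLp _
  set Eψ : L2 := (memLp_indicator_Icc hψ.ac.continuous a b).toLp _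
  set Ev : L2 := (memLp_indicator_Icc hv.ac.continuous a b).toLp _
  set Ew : L2 := ((Lp.memLp w).indicator (measurableSet_Icc (a := a) (b := b))).toLp _
  have hIoc : uIoc a b ⊆ Icc a b := by
    rw [uIoc_of_le hab]
    exact Ioc_subset_Icc_self
  -- A finite-dimensional span equals its double orthogonal complement, so it suffices to test `w -
  -- v` against every `f` orthogonal to `φ` and `ψ` on `[a, b]`.
  have key : Ew - Ev ∈ Submodule.span ℂ {Eφ, Eψ} := by
    have : FiniteDimensional ℂ (Submodule.span ℂ {Eφ, Eψ}) :=
      FiniteDimensional.span_of_finite ℂ (toFinite _)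
    rw [← Submodule.orthogonal_orthogonal (Submodule.span ℂ {Eφ, Eψ}),
      Submodule.mem_orthogonal']
    intro f hf
    rw [Submodule.mem_orthogonal] at hf
    have h1 := hf Eφ (Submodule.subset_span (by simp))
    have h2 := hf Eψ (Submodule.subset_span (by simp))
    rw [inner_indicator_left hab hEφ] at h1
    rw [inner_indicator_left hab hEψ] at h2
    obtain ⟨u, u₁, hu, hua, hu₁a⟩ := exists_isSolOn hg₁ hg₂ hs
      (L2.locallyIntegrable f) a b a 0 0
    have hub : u b = 0 := by
      simpa [hua, hu₁a, hφb, hφ₁b, h1] using (hu.integral_lagrange hφ hIoc).symm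
    have hu₁b : u₁ b = 0 := by
      simpa [hua, hu₁a, hψb, hψ₁b, h2] using (hu.integral_lagrange hψ hIoc).symm
    have hEu := (memLp_indicator_Icc hu.ac.continuous a b).coeFn_toLp
    have hEf := ((Lp.memLp f).indicator (measurableSet_Icc (a := a) (b := b))).coeFn_toLp
    -- All four boundary values vanish, so the extension of `u` by zero is admissible in the
    -- hypothesis `H`.
    have h3 := H _ _ (hu.mem_graph_domRestrict hab hua hub hu₁a hu₁b hEu hEf)
    rw [inner_indicator_right hab hEu, inner_indicator_right hab hEf] at h3
    have h4 := hu.integral_lagrange hv hIoc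
    have i1 : IntervalIntegrable (fun x => f x * conj (v x)) volume a b :=
      ((L2.locallyIntegrable f).intervalIntegrable a b).mul_continuousOn
        hv.ac.conj.continuous.continuousOn
    have i2 : IntervalIntegrable (fun x => u x * conj (k x)) volume a b := by
      have hk : IntervalIntegrable (fun x => conj (k x)) volume a b :=
        ((Lp.memLp k).star.locallyIntegrable one_le_two).intervalIntegrable a b
      exact hk.continuousOn_mul hu.ac.continuous.continuousOn
    rw [intervalIntegral.integral_sub i1 i2, hua, hu₁a, hub, hu₁b] at h4
    rw [inner_sub_left, inner_indicator_left hab hEw, inner_indicator_left hab hEv, h3]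
    linear_combination -h4
  obtain ⟨c, d, hcd⟩ := Submodule.mem_span_pair.1 key
  refine ⟨_, _, (((hv.add_const_mul hφ c).add_const_mul hψ d).congr ?_), ?_⟩
  · exact Eventually.of_forall fun x _ => by simp
  · have e : Ew = Ev + c • Eφ + d • Eψ := by
      rw [add_assoc, hcd]
      abel
    have e' : Ew =ᵐ[volume] fun x => Ev x + c * Eφ x + d * Eψ x := by
      rw [e]
      filter_upwards [Lp.coeFn_add (Ev + c • Eφ) (d • Eψ), Lp.coeFn_add Ev (c • Eφ),
        Lp.coeFn_smul c Eφ, Lp.coeFn_smul d Eψ] with x h1 h2 h3 h4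
      simp only [h1, h2, h3, h4, Pi.add_apply, Pi.smul_apply, smul_eq_mul]
    filter_upwards [e', hEφ, hEψ, hEv, hEw] with x h0 h1 h2 h3 h4 hx
    rw [h1, h2, h3, h4] at h0
    simp only [indicator_of_mem hx] at h0
    simp only [Pi.add_apply, Pi.smul_apply, smul_eq_mul, h0]

theorem eqOn_Ioo_of_ae_eq {f g : ℝ → ℂ} (hf : Continuous f) (hg : Continuous g) {a b : ℝ}
    (h : ∀ᵐ x : ℝ, x ∈ Icc a b → f x = g x) : EqOn f g (Ioo a b) := by
  refine Measure.eqOn_open_of_ae_eq (μ := volume) ?_ isOpen_Ioo hf.continuousOn hg.continuousOn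
  rw [Filter.EventuallyEq, ae_restrict_iff' measurableSet_Ioo]
  exact h.mono fun x hx hS => hx (Ioo_subset_Icc_self hS)

/-- The pairs formally adjoint to the pre-minimal operator belong to the graph of the maximal
operator generated by the Lagrange adjoint expression. -/
theorem mem_graph_of_formal_adjoint (hg₁ : MemLpLoc g₁ 2) (hg₂ : MemLpLoc g₂ 2)
    (hs : MemLpLoc s 1) {w k : L2}
    (H : ∀ f h : L2, (f, h) ∈ ((maxOp g₁ g₂ s).domRestrict compactSupp).graph →
      ⟪w, h⟫_ℂ = ⟪k, f⟫_ℂ) :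
    (w, k) ∈ (maxOp (conjFun g₂) (conjFun g₁) (conjFun s)).graph := by
  have hloc := fun n : ℕ => exists_isSolOn_of_formal_adjoint hg₁ hg₂ hs H
    (a := -(n : ℝ)) (b := n) (by linarith [n.cast_nonneg (α := ℝ)])
  choose V V₁ hV hVw using hloc
  have hw : HasACRep w := hasACRep_of_local fun n => ⟨V n, (hV n).ac, hVw n⟩
  obtain ⟨u, hu, huw⟩ := hw
  have hVu : ∀ n : ℕ, EqOn (V n) u (Ioo (-(n : ℝ)) n) := fun n =>
    eqOn_Ioo_of_ae_eq (hV n).ac.continuous hu.continuous (by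
      filter_upwards [hVw n, huw] with x h1 h2 hx
      rw [h1 hx, h2])
  have hV₁u : ∀ n : ℕ, ∀ᵐ x : ℝ, x ∈ Icc (-(n : ℝ)) n →
      V₁ n x = preQuasiDeriv (conjFun g₂) u x := by
    intro n
    -- The end points are discarded because equality of derivatives needs equality of the functions
    -- on a neighbourhood.
    filter_upwards [(hV n).deriv_eq, Ioo_ae_eq_Icc (μ := volume) (a := -(n : ℝ)) (b := n)]
      with x h1 h2 hx
    have hx' : x ∈ Ioo (-(n : ℝ)) n := (iff_of_eq h2).2 hx
    have hd : deriv (V n) x = deriv u x :=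
      ((hVu n).eventuallyEq_of_mem (Ioo_mem_nhds hx'.1 hx'.2)).deriv_eq
    rw [preQuasiDeriv, ← hd, h1 hx, hVu n hx']
    ring
  obtain ⟨u₁, hu₁, hu₁e⟩ := hasACRep_of_local fun n => ⟨V₁ n, (hV n).ac₁, hV₁u n⟩
  have hV₁u₁ : ∀ n : ℕ, EqOn (V₁ n) u₁ (Ioo (-(n : ℝ)) n) := fun n =>
    eqOn_Ioo_of_ae_eq (hV n).ac₁.continuous hu₁.continuous (by
      filter_upwards [hV₁u n, hu₁e] with x h1 h2 hx
      rw [h1 hx, h2])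
  refine IsSolOn.mem_graph (u := u) (u₁ := u₁) ⟨hu, hu₁, ?_, ?_⟩ huw
  · filter_upwards [hu₁e] with x hx _
    rw [hx, preQuasiDeriv]
    ring
  · filter_upwards [ae_all_iff.2 fun n => (hV n).deriv₁_eq] with x hx _
    obtain ⟨n, hn⟩ := exists_nat_gt |x|
    have hx' : x ∈ Ioo (-(n : ℝ)) n := abs_lt.1 hn
    have hd : deriv (V₁ n) x = deriv u₁ x :=
      ((hV₁u₁ n).eventuallyEq_of_mem (Ioo_mem_nhds hx'.1 hx'.2)).deriv_eq
    rw [← hd, hx n (Ioo_subset_Icc_self hx'), hV₁u₁ n hx', hVu n hx']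

end QuasiDiff

/-! ### The closure as a double adjoint. -/

/-- The closure of a densely defined closable operator is the adjoint of its adjoint. -/
theorem LinearPMap.mem_graph_closure_iff {E F : Type*} [NormedAddCommGroup E]
    [InnerProductSpace ℂ E] [CompleteSpace E] [NormedAddCommGroup F] [InnerProductSpace ℂ F]
    [CompleteSpace F] {T : E →ₗ.[ℂ] F} (hT : Dense (T.domain : Set E)) (hc : T.IsClosable)
    {f : E} {h : F} :
    (f, h) ∈ T.closure.graph ↔ ∀ y : T†.domain, ⟪f, T† y⟫_ℂ = ⟪h, (y : F)⟫_ℂ := by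
  rw [← hc.graph_closure_eq_closure_graph, ← SetLike.mem_coe,
    Submodule.topologicalClosure_coe]
  constructor
  · intro hf y
    have hcl : _root_.IsClosed {p : E × F | ⟪p.1, T† y⟫_ℂ = ⟪p.2, (y : F)⟫_ℂ} :=
      isClosed_eq (by fun_prop) (by fun_prop)
    refine closure_minimal ?_ hcl hf
    rintro ⟨x, z⟩ hx
    obtain ⟨x', rfl, rfl⟩ := T.mem_graph_iff.1 hx
    exact ((adjoint_isFormalAdjoint hT).symm x' y).symm
  · intro H
    -- The product carries the sup norm; orthogonal complements require its Hilbert space version,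
    -- which has the same topology.
    let e : WithLp 2 (E × F) ≃ₗ[ℂ] E × F := WithLp.linearEquiv 2 ℂ (E × F)
    let G : Submodule ℂ (WithLp 2 (E × F)) := T.graph.comap (e : WithLp 2 (E × F) →ₗ[ℂ] E × F)
    have hmem : WithLp.toLp 2 (f, h) ∈ G.topologicalClosure := by
      rw [← Submodule.orthogonal_orthogonal_eq_closure, Submodule.mem_orthogonal]
      intro q hq
      rw [Submodule.mem_orthogonal] at hq
      -- Orthogonality of `q` to the graph says exactly that `q.snd` is in the domain of `T†` with
      -- `T† q.snd = -q.fst`.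
      have hq' : ∀ x : T.domain, ⟪-q.fst, (x : E)⟫_ℂ = ⟪q.snd, T x⟫_ℂ := by
        intro x
        have h1 := hq (WithLp.toLp 2 ((x : E), T x)) (T.mem_graph x)
        rw [← inner_conj_symm, map_eq_zero, WithLp.prod_inner_apply] at h1
        rw [inner_neg_left]
        exact neg_eq_of_add_eq_zero_right h1
      have hdom : q.snd ∈ T†.domain := mem_adjoint_domain_of_exists _ ⟨_, hq'⟩
      have hval : T† ⟨q.snd, hdom⟩ = -q.fst := adjoint_apply_eq hT ⟨q.snd, hdom⟩ hq'
      have h1 := H ⟨q.snd, hdom⟩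
      rw [hval, inner_neg_right, neg_eq_iff_add_eq_zero] at h1
      rw [← inner_conj_symm, map_eq_zero, WithLp.prod_inner_apply]
      exact h1
    rw [← SetLike.mem_coe, Submodule.topologicalClosure_coe] at hmem
    have := image_closure_subset_closure_image (WithLp.prod_continuous_ofLp 2 E F)
      (mem_image_of_mem _ hmem)
    refine closure_mono ?_ this
    rintro _ ⟨x, hx, rfl⟩
    exact hx

/-! ### The Lagrange identity on the line, adjoints and minimal domains. -/

namespace QuasiDiff

variable {g₁ g₂ s : ℝ → ℂ}

/-- `[u,v](x)` for general coefficients. -/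
noncomputable def lagrangeBracket (g₁ g₂ : ℝ → ℂ) (u v : L2) (x : ℝ) : ℂ :=
  acRep u x * conj (quasiDeriv₁ (conjFun g₂) (acRep v) x)
    - quasiDeriv₁ g₁ (acRep u) x * conj (acRep v x)

/-- The Lagrange identity on the whole line. -/
theorem exists_tendsto_lagrangeBracket (u : (maxOp g₁ g₂ s).domain)
    (v : (maxOp (conjFun g₂) (conjFun g₁) (conjFun s)).domain) :
    ∃ c d : ℂ, Tendsto (lagrangeBracket g₁ g₂ u v) atTop (𝓝 c) ∧
      Tendsto (lagrangeBracket g₁ g₂ u v) atBot (𝓝 d) ∧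
      ⟪(v : L2), maxOp g₁ g₂ s u⟫_ℂ
        - ⟪maxOp (conjFun g₂) (conjFun g₁) (conjFun s) v, (u : L2)⟫_ℂ = c - d := by
  have hu := isSolOn_of_mem_domain u
  have hv := isSolOn_of_mem_domain v
  set h : L2 := maxOp g₁ g₂ s u
  set k : L2 := maxOp (conjFun g₂) (conjFun g₁) (conjFun s) v
  set F : ℝ → ℂ := fun x => h x * conj (acRep (v : L2) x) - acRep (u : L2) x * conj (k x)
  have hFe : F =ᵐ[volume] fun x => h x * conj ((v : L2) x) - (u : L2) x * conj (k x) := by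
    filter_upwards [acRep_ae_eq u, acRep_ae_eq v] with x h1 h2
    simp only [F, h1, h2]
  have hF : Integrable F volume :=
    ((integrable_mul_conj (v : L2) h).sub (integrable_mul_conj k (u : L2))).congr hFe.symm
  have hint : ⟪(v : L2), h⟫_ℂ - ⟪k, (u : L2)⟫_ℂ = ∫ x, F x := by
    rw [integral_congr_ae hFe, integral_sub (integrable_mul_conj _ _) (integrable_mul_conj _ _),
      inner_eq_integral, inner_eq_integral]
  -- The bracket is a primitive of `F`, which is integrable as a combination of products of `L²`
  -- functions; this yields both limits.
  have hb : ∀ x, lagrangeBracket g₁ g₂ u v x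
      = lagrangeBracket g₁ g₂ u v 0 + ∫ t in (0 : ℝ)..x, F t := by
    intro x
    rw [hu.integral_lagrange hv (subset_univ _)]
    simp only [lagrangeBracket]
    ring
  refine ⟨lagrangeBracket g₁ g₂ u v 0 + ∫ t in Ioi (0 : ℝ), F t,
    lagrangeBracket g₁ g₂ u v 0 - ∫ t in Iic (0 : ℝ), F t, ?_, ?_, ?_⟩
  · exact ((intervalIntegral_tendsto_integral_Ioi 0 hF.integrableOn tendsto_id).const_add _).congr
      fun x => (hb x).symm
  · have h1 := (intervalIntegral_tendsto_integral_Iic 0 hF.integrableOn tendsto_id).const_sub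
      (lagrangeBracket g₁ g₂ u v 0)
    refine h1.congr fun x => ?_
    rw [hb x, id, intervalIntegral.integral_symm 0 x, sub_neg_eq_add]
  · rw [hint, ← intervalIntegral.integral_Iic_add_Ioi hF.integrableOn hF.integrableOn (b := 0)]
    ring

/-- A compactly supported element of the maximal domain, its derivative and its quasi-derivative
vanish outside a bounded interval. -/
theorem exists_eq_zero_of_compactSupp (u : (maxOp g₁ g₂ s).domain)
    (hu : (u : L2) ∈ compactSupp) :
    ∃ R : ℝ, 0 ≤ R ∧ ∀ x ∉ Icc (-R) R, acRep (u : L2) x = 0 ∧ deriv (acRep (u : L2)) x = 0 ∧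
      quasiDeriv₁ g₁ (acRep (u : L2)) x = 0 := by
  obtain ⟨K, hK, hKu⟩ := hu
  obtain ⟨R, hR0, hR⟩ := hK.isBounded.subset_closedBall_lt 0 0
  rw [Real.closedBall_eq_Icc, zero_sub, zero_add] at hR
  have hsol := isSolOn_of_mem_domain u
  have hopen : IsOpen (Icc (-R) R)ᶜ := isClosed_Icc.isOpen_compl
  have h0 : EqOn (acRep (u : L2)) 0 (Icc (-R) R)ᶜ := by
    refine Measure.eqOn_open_of_ae_eq (μ := volume) ?_ hopen hsol.ac.continuous.continuousOn
      continuousOn_const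
    rw [Filter.EventuallyEq, ae_restrict_iff' hopen.measurableSet]
    filter_upwards [hKu, acRep_ae_eq u] with x h1 h2 hx
    rw [h2, h1 fun hxK => hx (hR hxK)]
    rfl
  have hd : ∀ x ∈ (Icc (-R) R)ᶜ, deriv (acRep (u : L2)) x = 0 := by
    intro x hx
    rw [(h0.eventuallyEq_of_mem (hopen.mem_nhds hx)).deriv_eq]
    simp
  have h1 : EqOn (quasiDeriv₁ g₁ (acRep (u : L2))) 0 (Icc (-R) R)ᶜ := by
    refine Measure.eqOn_open_of_ae_eq (μ := volume) ?_ hopen hsol.ac₁.continuous.continuousOn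
      continuousOn_const
    rw [Filter.EventuallyEq, ae_restrict_iff' hopen.measurableSet]
    filter_upwards [hsol.preQuasiDeriv_ae_eq] with x h1 hx
    rw [h1, preQuasiDeriv, hd x hx, h0 hx]
    simp
  exact ⟨R, hR0.le, fun x hx => ⟨h0 hx, hd x hx, h1 hx⟩⟩

theorem inner_maxOp_eq_of_compactSupp (u : (maxOp g₁ g₂ s).domain) (hu : (u : L2) ∈ compactSupp)
    (v : (maxOp (conjFun g₂) (conjFun g₁) (conjFun s)).domain) :
    ⟪(v : L2), maxOp g₁ g₂ s u⟫_ℂ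
      = ⟪maxOp (conjFun g₂) (conjFun g₁) (conjFun s) v, (u : L2)⟫_ℂ := by
  obtain ⟨c, d, hc, hd, hcd⟩ := exists_tendsto_lagrangeBracket u v
  obtain ⟨R, -, hR⟩ := exists_eq_zero_of_compactSupp u hu
  have h0 : ∀ x ∉ Icc (-R) R, 0 = lagrangeBracket g₁ g₂ u v x := fun x hx => by
    simp [lagrangeBracket, hR x hx]
  have hc0 : c = 0 := by
    refine tendsto_nhds_unique hc (tendsto_const_nhds.congr' ?_)
    filter_upwards [eventually_gt_atTop R] with x hx
    exact h0 x fun h => not_le.2 hx h.2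
  have hd0 : d = 0 := by
    refine tendsto_nhds_unique hd (tendsto_const_nhds.congr' ?_)
    filter_upwards [eventually_lt_atBot (-R)] with x hx
    exact h0 x fun h => not_le.2 hx h.1
  rw [hc0, hd0, sub_zero] at hcd
  exact sub_eq_zero.1 hcd

/-- If `w` is orthogonal to the domain, then `(0, w)` is a formally adjoint pair, hence lies in the
graph of an operator, and `w = 0`. No explicit test functions are needed. -/
theorem dense_domain_domRestrict (hg₁ : MemLpLoc g₁ 2) (hg₂ : MemLpLoc g₂ 2)
    (hs : MemLpLoc s 1) :
    Dense (((maxOp g₁ g₂ s).domRestrict compactSupp).domain : Set L2) := by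
  rw [Submodule.dense_iff_topologicalClosure_eq_top, Submodule.topologicalClosure_eq_top_iff,
    Submodule.eq_bot_iff]
  intro w hw
  have h := mem_graph_of_formal_adjoint hg₁ hg₂ hs (w := 0) (k := w) fun f h hf => by
    rw [inner_zero_left]
    exact ((Submodule.mem_orthogonal' _ _).1 hw f (LinearPMap.mem_domain_of_mem_graph hf)).symm
  exact LinearPMap.graph_fst_eq_zero_snd _ h rfl

/-- One inclusion is `mem_graph_of_formal_adjoint`; the other is the Lagrange identity without
boundary terms. -/
theorem adjoint_domRestrict (hg₁ : MemLpLoc g₁ 2) (hg₂ : MemLpLoc g₂ 2) (hs : MemLpLoc s 1) :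
    ((maxOp g₁ g₂ s).domRestrict compactSupp)†
      = maxOp (conjFun g₂) (conjFun g₁) (conjFun s) := by
  have hd := dense_domain_domRestrict hg₁ hg₂ hs
  apply le_antisymm
  · refine LinearPMap.le_of_le_graph ?_
    rintro ⟨w, k⟩ hw
    obtain ⟨y, rfl, rfl⟩ := (LinearPMap.mem_graph_iff _).1 hw
    refine mem_graph_of_formal_adjoint hg₁ hg₂ hs fun f h hf => ?_
    obtain ⟨x, rfl, rfl⟩ := (LinearPMap.mem_graph_iff _).1 hf
    exact (LinearPMap.adjoint_isFormalAdjoint hd y x).symm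
  · refine LinearPMap.IsFormalAdjoint.le_adjoint hd (LinearPMap.IsFormalAdjoint.symm ?_)
    rintro y ⟨x, hx⟩
    rw [← inner_maxOp_eq_of_compactSupp ⟨x, hx.2⟩ hx.1 y]
    rfl

/-- Passing to the Lagrange adjoint is an involution on coefficients, so every maximal operator is
itself the adjoint of a pre-minimal one. -/
theorem maxOp_isClosed (hg₁ : MemLpLoc g₁ 2) (hg₂ : MemLpLoc g₂ 2) (hs : MemLpLoc s 1) :
    (maxOp g₁ g₂ s).IsClosed := by
  have h := LinearPMap.adjoint_isClosed (dense_domain_domRestrict hg₂.conj hg₁.conj hs.conj)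
  rwa [adjoint_domRestrict hg₂.conj hg₁.conj hs.conj, conjFun_conjFun, conjFun_conjFun,
    conjFun_conjFun] at h

theorem domRestrict_isClosable (hg₁ : MemLpLoc g₁ 2) (hg₂ : MemLpLoc g₂ 2) (hs : MemLpLoc s 1) :
    ((maxOp g₁ g₂ s).domRestrict compactSupp).IsClosable :=
  (maxOp_isClosed hg₁ hg₂ hs).isClosable.leIsClosable LinearPMap.domRestrict_le

/-- The domain of the minimal operator. -/
theorem mem_domain_closure_iff (hg₁ : MemLpLoc g₁ 2) (hg₂ : MemLpLoc g₂ 2) (hs : MemLpLoc s 1)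
    (u : L2) :
    u ∈ ((maxOp g₁ g₂ s).domRestrict compactSupp).closure.domain ↔
      u ∈ (maxOp g₁ g₂ s).domain ∧
        ∀ v ∈ (maxOp (conjFun g₂) (conjFun g₁) (conjFun s)).domain,
          limUnder atTop (lagrangeBracket g₁ g₂ u v)
            - limUnder atBot (lagrangeBracket g₁ g₂ u v) = 0 := by
  have hd := dense_domain_domRestrict hg₁ hg₂ hs
  have hc := domRestrict_isClosable hg₁ hg₂ hs
  have hgr := fun f h => LinearPMap.mem_graph_closure_iff hd hc (f := f) (h := h)
  rw [adjoint_domRestrict hg₁ hg₂ hs] at hgr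
  rw [LinearPMap.mem_domain_iff]
  constructor
  · rintro ⟨h, hh⟩
    rw [hgr] at hh
    -- Testing only against compactly supported `v`, with the two expressions interchanged, already
    -- places `(u, h)` in the graph of the maximal operator.
    have hmem := mem_graph_of_formal_adjoint hg₂.conj hg₁.conj hs.conj (w := u) (k := h)
      fun f k hf => by
        obtain ⟨y, rfl, rfl⟩ := (LinearPMap.mem_graph_iff _).1 (mem_graph_domRestrict_iff.1 hf).2
        exact hh y
    simp only [conjFun_conjFun] at hmem
    obtain ⟨u, rfl, rfl⟩ := (LinearPMap.mem_graph_iff _).1 hmem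
    refine ⟨u.2, fun v hv => ?_⟩
    obtain ⟨c, d, hc, hd, hcd⟩ := exists_tendsto_lagrangeBracket u ⟨v, hv⟩
    rw [hc.limUnder_eq, hd.limUnder_eq, ← hcd, ← inner_conj_symm, ← hh ⟨v, hv⟩, inner_conj_symm,
      sub_self]
  · rintro ⟨hu, H⟩
    refine ⟨maxOp g₁ g₂ s ⟨u, hu⟩, (hgr _ _).2 fun v => ?_⟩
    obtain ⟨c, d, hc, hd, hcd⟩ := exists_tendsto_lagrangeBracket ⟨u, hu⟩ v
    have h1 := H v v.2
    rw [hc.limUnder_eq, hd.limUnder_eq, ← hcd] at h1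
    rw [← inner_conj_symm, ← sub_eq_zero.1 h1, inner_conj_symm]

/-- Transfers the description of the minimal domain from `L₀` to `L₀⁺`, where the roles of `u` and
`v` are swapped. -/
theorem lagrangeBracket_conj (u v : L2) (x : ℝ) :
    lagrangeBracket (conjFun g₂) (conjFun g₁) v u x = -conj (lagrangeBracket g₁ g₂ u v x) := by
  simp only [lagrangeBracket, conjFun_conjFun, map_sub, map_mul, Complex.conj_conj]
  ring

end QuasiDiff

namespace QuasiDiff

variable {g₁ g₂ s : ℝ → ℂ}

/-! ### Sobolev regularity -/

theorem integrable_of_eq_zero_off_Icc {f : ℝ → ℂ} (hf : LocallyIntegrable f volume) {a b : ℝ}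
    (h : ∀ x ∉ Icc a b, f x = 0) : Integrable f volume :=
  (integrableOn_iff_integrable_of_support_subset fun x hx => by
    by_contra hx'
    exact hx (h x hx')).1 (hf.integrableOn_isCompact isCompact_Icc)

theorem memLp_of_eq_zero_off_Icc {f : ℝ → ℂ} {p : ENNReal} (hf : MemLpLoc f p) {a b : ℝ}
    (h : ∀ x ∉ Icc a b, f x = 0) : MemLp f p volume := by
  have h1 := (memLp_indicator_iff_restrict measurableSet_Icc).2 (hf (Icc a b) isCompact_Icc)
  rwa [indicator_eq_self.2 fun x hx => by_contra fun hx' => hx (h x hx')] at h1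

theorem deriv_eq_zero_off_Icc {w : ℝ → ℂ} {a b : ℝ} (h : ∀ x ∉ Icc a b, w x = 0) :
    ∀ x ∉ Icc a b, deriv w x = 0 := by
  intro x hx
  have h0 : w =ᶠ[𝓝 x] fun _ => 0 := by
    filter_upwards [isClosed_Icc.isOpen_compl.mem_nhds hx] with y hy
    exact h y hy
  rw [h0.deriv_eq, deriv_const]

/-- The integral of the derivative of a compactly supported absolutely continuous function. -/
theorem ACLoc.integral_deriv_eq_zero {w : ℝ → ℂ} (hw : ACLoc w) {a b : ℝ} (hab : a ≤ b)
    (h : ∀ x ∉ Icc a b, w x = 0) : Integrable (deriv w) volume ∧ ∫ x, deriv w x = 0 := by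
  have hd := deriv_eq_zero_off_Icc h
  refine ⟨integrable_of_eq_zero_off_Icc hw.locallyIntegrable_deriv hd, ?_⟩
  -- Enlarging the interval by 1 on each side moves the end points to where `w` is known to vanish.
  rw [← setIntegral_eq_integral_of_forall_compl_eq_zero (s := Ioc (a - 1) b) fun x hx => hd x
    fun hx' => hx ⟨by linarith [hx'.1], hx'.2⟩,
    ← setIntegral_eq_of_subset_of_forall_sdiff_eq_zero (t := Ioc (a - 1) (b + 1))
      measurableSet_Ioc (Ioc_subset_Ioc_right (by linarith)) fun x hx => hd x fun hx' =>
        hx.2 ⟨hx.1.1, hx'.2⟩,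
    ← intervalIntegral.integral_of_le (by linarith), hw.integral_deriv,
    h (b + 1) fun hx => by linarith [hx.2], h (a - 1) fun hx => by linarith [hx.1], sub_zero]

/-- Almost everywhere `u' = u^{[1]} + g₁ u`: a continuous function plus an `L²_loc` function times a
continuous one. -/
theorem memLpLoc_deriv_acRep (hg₁ : MemLpLoc g₁ 2) (u : (maxOp g₁ g₂ s).domain) :
    MemLpLoc (deriv (acRep (u : L2))) 2 := by
  have hu := isSolOn_of_mem_domain u
  refine ((MemLpLoc.of_continuous hu.ac₁.continuous 2).add
    (hg₁.mul_continuous hu.ac.continuous)).congr ?_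
  filter_upwards [hu.deriv_eq] with x hx
  rw [hx (mem_univ x)]

/-- The product `uφ` is absolutely continuous with bounded support, so the integral of `u'φ + uφ'`
vanishes. -/
theorem isWeakDeriv_acRep (u : (maxOp g₁ g₂ s).domain) :
    IsWeakDeriv (u : L2) (deriv (acRep (u : L2))) := by
  intro φ hφ hφc
  have hu := isSolOn_of_mem_domain u
  obtain ⟨R, hR0, hR⟩ := hφc.isCompact.isBounded.subset_closedBall_lt 0 0
  rw [Real.closedBall_eq_Icc, zero_sub, zero_add] at hR
  have hφ0 : ∀ x ∉ Icc (-R) R, φ x = 0 := fun x hx =>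
    image_eq_zero_of_notMem_tsupport fun h => hx (hR h)
  have hφ1 : ContDiff ℝ 1 φ := hφ.of_le (by exact_mod_cast le_top)
  have hφd : Continuous (deriv φ) := hφ1.continuous_deriv le_rfl
  have hw := (hu.ac.mul (ACLoc.of_contDiff hφ1)).integral_deriv_eq_zero
    (a := -R) (b := R) (by linarith) fun x hx => by rw [hφ0 x hx, mul_zero]
  have e : deriv (fun x => acRep (u : L2) x * φ x) =ᵐ[volume]
      fun x => deriv (acRep (u : L2)) x * φ x + acRep (u : L2) x * deriv φ x := by
    filter_upwards [hu.ac.ae_differentiableAt] with x hx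
    have hd : HasDerivAt (fun x => acRep (u : L2) x * φ x) _ x :=
      hx.hasDerivAt.mul (hφ1.differentiable one_ne_zero x).hasDerivAt
    exact hd.deriv
  have i1 : Integrable (fun x => deriv (acRep (u : L2)) x * φ x) volume := by
    refine integrable_of_eq_zero_off_Icc (a := -R) (b := R) ?_ fun x hx => by
      rw [hφ0 x hx, mul_zero]
    exact locallyIntegrable_of_intervalIntegrable fun a b =>
      (hu.ac.locallyIntegrable_deriv.intervalIntegrable a b).mul_continuousOn
        hφ1.continuous.continuousOn
  have i2 : Integrable (fun x => acRep (u : L2) x * deriv φ x) volume :=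
    integrable_of_eq_zero_off_Icc (a := -R) (b := R)
      (hu.ac.continuous.mul hφd).locallyIntegrable fun x hx => by
        rw [deriv_eq_zero_off_Icc hφ0 x hx, mul_zero]
  have h1 := hw.2
  rw [integral_congr_ae e, integral_add i1 i2] at h1
  have h2 : ∫ x, (u : L2) x * deriv φ x = ∫ x, acRep (u : L2) x * deriv φ x :=
    integral_congr_ae ((acRep_ae_eq u).mono fun x hx => by simp only [hx])
  rw [h2]
  linear_combination h1

theorem memW12Loc_of_mem_domain (hg₁ : MemLpLoc g₁ 2) {u : L2}
    (hu : u ∈ (maxOp g₁ g₂ s).domain) : MemW12Loc u :=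
  ⟨fun K _ => (Lp.memLp u).restrict K, _, memLpLoc_deriv_acRep hg₁ ⟨u, hu⟩,
    isWeakDeriv_acRep ⟨u, hu⟩⟩

theorem memW12Comp_of_mem_domain (hg₁ : MemLpLoc g₁ 2) {u : L2}
    (hu : u ∈ ((maxOp g₁ g₂ s).domRestrict compactSupp).domain) : MemW12Comp u := by
  obtain ⟨R, -, hR⟩ := exists_eq_zero_of_compactSupp (g₁ := g₁) ⟨u, hu.2⟩ hu.1
  exact ⟨⟨Lp.memLp u, _, memLp_of_eq_zero_off_Icc (memLpLoc_deriv_acRep hg₁ ⟨u, hu.2⟩)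
    fun x hx => (hR x hx).2.1, isWeakDeriv_acRep ⟨u, hu.2⟩⟩, hu.1⟩

/-! ### The quadratic form -/

/-- Substituting `u^{[1]} = u' - g₁u` in `l[u] ū`, the `g₁g₂|u|²` terms cancel and what remains is
`|u'|² - g₁uū' - g₂u'ū + s|u|² - (u^{[1]}ū)'`. The last term integrates to zero by compact support.
-/
theorem inner_domRestrict_self (hg₁ : MemLpLoc g₁ 2) (hg₂ : MemLpLoc g₂ 2) (hs : MemLpLoc s 1)
    (f : (maxOp g₁ g₂ s).domain) (hf : (f : L2) ∈ compactSupp) {u : ℝ → ℂ}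
    (hu : u = acRep (f : L2)) :
    Integrable (fun x => ‖deriv u x‖ ^ 2) volume ∧
    Integrable (fun x => g₁ x * u x * conj (deriv u x) + g₂ x * deriv u x * conj (u x)) volume ∧
    Integrable (fun x => s x * (‖u x‖ ^ 2 : ℝ)) volume ∧
    ⟪(f : L2), maxOp g₁ g₂ s f⟫_ℂ = ((∫ x, ‖deriv u x‖ ^ 2 : ℝ) : ℂ)
      - (∫ x, (g₁ x * u x * conj (deriv u x) + g₂ x * deriv u x * conj (u x)))
      + ∫ x, s x * (‖u x‖ ^ 2 : ℝ) := by
  have hsol := isSolOn_of_mem_domain f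
  have hu' := memLpLoc_deriv_acRep hg₁ f
  have hfe := acRep_ae_eq f
  obtain ⟨R, hR0, hR⟩ := exists_eq_zero_of_compactSupp f hf
  rw [← hu] at hsol hu' hfe hR
  set u₁ := quasiDeriv₁ g₁ u
  have hR' : -R ≤ R := by linarith
  have hcu : Continuous fun x => conj (u x) := hsol.ac.conj.continuous
  have i1 : Integrable (fun x => ‖deriv u x‖ ^ 2) volume :=
    (memLp_two_iff_integrable_sq_norm (integrable_of_eq_zero_off_Icc
      (hu'.locallyIntegrable one_le_two) fun x hx => (hR x hx).2.1).1).1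
      (memLp_of_eq_zero_off_Icc hu' fun x hx => (hR x hx).2.1)
  have i2 : Integrable
      (fun x => g₁ x * u x * conj (deriv u x) + g₂ x * deriv u x * conj (u x)) volume := by
    refine integrable_of_eq_zero_off_Icc (a := -R) (b := R)
      (MemLpLoc.locallyIntegrable (p := 1) ?_ le_rfl) fun x hx => by simp [hR x hx]
    exact ((hg₁.mul_continuous hsol.ac.continuous).mul hu'.conj).add
      ((hg₂.mul hu').mul_continuous hcu)
  have i3 : Integrable (fun x => s x * (‖u x‖ ^ 2 : ℝ)) volume := by
    refine integrable_of_eq_zero_off_Icc (a := -R) (b := R)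
      ((hs.mul_continuous ?_).locallyIntegrable le_rfl) fun x hx => by simp [hR x hx]
    exact Complex.continuous_ofReal.comp (hsol.ac.continuous.norm.pow 2)
  refine ⟨i1, i2, i3, ?_⟩
  obtain ⟨i4, h4⟩ := (hsol.ac₁.mul hsol.ac.conj).integral_deriv_eq_zero hR' fun x hx => by
    rw [(hR x hx).1, map_zero, mul_zero]
  have e : (fun x => (maxOp g₁ g₂ s f : L2) x * conj ((f : L2) x)) =ᵐ[volume] fun x =>
      ((‖deriv u x‖ ^ 2 : ℝ) : ℂ)
        - (g₁ x * u x * conj (deriv u x) + g₂ x * deriv u x * conj (u x))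
        + s x * (‖u x‖ ^ 2 : ℝ) - deriv (fun x => u₁ x * conj (u x)) x := by
    filter_upwards [hfe, hsol.deriv_eq, hsol.deriv₁_eq, hsol.ac.ae_differentiableAt,
      hsol.ac₁.ae_differentiableAt] with x h1 h2 h3 d1 d2
    have c1 : HasDerivAt (fun x => conj (u x)) (conj (deriv u x)) x := d1.hasDerivAt.star
    have hd : HasDerivAt (fun x => u₁ x * conj (u x)) _ x := d2.hasDerivAt.mul c1
    have n1 : ((‖u x‖ ^ 2 : ℝ) : ℂ) = u x * conj (u x) := by
      rw [Complex.mul_conj, Complex.normSq_eq_norm_sq]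
    have n2 : ((‖deriv u x‖ ^ 2 : ℝ) : ℂ) = deriv u x * conj (deriv u x) := by
      rw [Complex.mul_conj, Complex.normSq_eq_norm_sq]
    rw [hd.deriv, ← h1, n1, n2, h3 (mem_univ x), h2 (mem_univ x)]
    ring
  have i1' : Integrable (fun x => ((‖deriv u x‖ ^ 2 : ℝ) : ℂ)) volume := i1.ofReal
  have i12 := i1'.sub i2
  rw [inner_eq_integral, integral_congr_ae e]
  refine (integral_sub (i12.add i3) i4).trans ?_
  rw [h4, sub_zero, ← integral_complex_ofReal]
  exact (integral_add i12 i3).trans (congrArg (· + _) (integral_sub i1' i2))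

end QuasiDiff

/-! ### Assembly of the five assertions. -/

open QuasiDiff in
theorem theorem1 (Q r s : ℝ → ℂ)
    (hs : MemLpLoc s 1) (hQ : MemLpLoc Q 2) (hr : MemLpLoc r 2) :
    -- 1. The pre-minimal operators are densely defined.
    (Dense ((opL00 Q r s).domain : Set L2) ∧ Dense ((opL00Plus Q r s).domain : Set L2)) ∧
    -- 2. Adjoints of the pre-minimal operators.
    ((opL00 Q r s)† = opLPlus Q r s ∧ (opL00Plus Q r s)† = opL Q r s) ∧
    -- 3. Closedness and closability.
    ((opL Q r s).IsClosed ∧ (opLPlus Q r s).IsClosed ∧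
      (opL00 Q r s).IsClosable ∧ (opL00Plus Q r s).IsClosable) ∧
    -- 4. The limits of `[u,v]` at `±∞` exist, and the domains of the minimal operators.
    ((∀ u ∈ (opL Q r s).domain, ∀ v ∈ (opLPlus Q r s).domain,
        (∃ c : ℂ, Tendsto (bracket Q r u v) atTop (𝓝 c)) ∧
        (∃ c : ℂ, Tendsto (bracket Q r u v) atBot (𝓝 c))) ∧
      ((opL0 Q r s).domain : Set L2) =
        {u | u ∈ (opL Q r s).domain ∧
          ∀ v ∈ (opLPlus Q r s).domain, bracketTotal Q r u v = 0} ∧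
      ((opL0Plus Q r s).domain : Set L2) =
        {v | v ∈ (opLPlus Q r s).domain ∧
          ∀ u ∈ (opL Q r s).domain, bracketTotal Q r u v = 0} ∧
      (∀ u ∈ (opL Q r s).domain, MemW12Loc u) ∧
      (∀ v ∈ (opLPlus Q r s).domain, MemW12Loc v) ∧
      (∀ u ∈ (opL00 Q r s).domain, MemW12Comp u) ∧
      (∀ v ∈ (opL00Plus Q r s).domain, MemW12Comp v)) ∧
    -- 5. The quadratic form of `L₀₀`; here `u` denotes the `AC_loc` representative of `f`, and
    -- the scalar product `(L₀₀ f, f)`, linear in the first factor, is `⟪f, L₀₀ f⟫_ℂ`.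
    (∀ f : (opL00 Q r s).domain, ∀ u : ℝ → ℂ, u = acRep (f : L2) →
      Integrable (fun x => ‖deriv u x‖ ^ 2) volume ∧
      Integrable (fun x => G₁ Q r x * u x * conj (deriv u x)
        + G₂ Q r x * deriv u x * conj (u x)) volume ∧
      Integrable (fun x => s x * (‖u x‖ ^ 2 : ℝ)) volume ∧
      ⟪(f : L2), opL00 Q r s f⟫_ℂ =
        ((∫ x, ‖deriv u x‖ ^ 2 : ℝ) : ℂ)
        - (∫ x, (G₁ Q r x * u x * conj (deriv u x) + G₂ Q r x * deriv u x * conj (u x)))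
        + ∫ x, s x * (‖u x‖ ^ 2 : ℝ)) := by
  have h₁ : MemLpLoc (G₁ Q r) 2 := hQ.add (hr.const_mul Complex.I)
  have h₂ : MemLpLoc (G₂ Q r) 2 := hQ.sub (hr.const_mul Complex.I)
  -- `limUnder` commutes with `z ↦ -conj z` here because the limits are known to exist.
  have hplus : ∀ v u : L2, u ∈ (opL Q r s).domain → v ∈ (opLPlus Q r s).domain →
      limUnder atTop (lagrangeBracket (conjFun (G₂ Q r)) (conjFun (G₁ Q r)) v u)
        - limUnder atBot (lagrangeBracket (conjFun (G₂ Q r)) (conjFun (G₁ Q r)) v u)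
        = -conj (bracketTotal Q r u v) := by
    intro v u hu hv
    obtain ⟨c, d, hc, hd, -⟩ := exists_tendsto_lagrangeBracket ⟨u, hu⟩ ⟨v, hv⟩
    have e : bracketTotal Q r u v = c - d := by
      rw [← hc.limUnder_eq, ← hd.limUnder_eq]
      rfl
    have hc' : Tendsto (lagrangeBracket (conjFun (G₂ Q r)) (conjFun (G₁ Q r)) v u) atTop
        (𝓝 (-conj c)) := by
      rw [funext (lagrangeBracket_conj u v)]
      exact ((Complex.continuous_conj.tendsto c).comp hc).neg
    have hd' : Tendsto (lagrangeBracket (conjFun (G₂ Q r)) (conjFun (G₁ Q r)) v u) atBot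
        (𝓝 (-conj d)) := by
      rw [funext (lagrangeBracket_conj u v)]
      exact ((Complex.continuous_conj.tendsto d).comp hd).neg
    rw [hc'.limUnder_eq, hd'.limUnder_eq, e, map_sub]
    ring
  have hplusOp : maxOp (conjFun (conjFun (G₁ Q r))) (conjFun (conjFun (G₂ Q r)))
      (conjFun (conjFun s)) = opL Q r s := by
    simp only [conjFun_conjFun, opL]
  refine ⟨⟨dense_domain_domRestrict h₁ h₂ hs, dense_domain_domRestrict h₂.conj h₁.conj hs.conj⟩,
    ⟨adjoint_domRestrict h₁ h₂ hs,
      (adjoint_domRestrict h₂.conj h₁.conj hs.conj).trans hplusOp⟩,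
    ⟨maxOp_isClosed h₁ h₂ hs, maxOp_isClosed h₂.conj h₁.conj hs.conj,
      domRestrict_isClosable h₁ h₂ hs, domRestrict_isClosable h₂.conj h₁.conj hs.conj⟩,
    ⟨?_, ?_, ?_, fun u hu => memW12Loc_of_mem_domain h₁ hu,
      fun v hv => memW12Loc_of_mem_domain h₂.conj hv,
      fun u hu => memW12Comp_of_mem_domain h₁ hu,
      fun v hv => memW12Comp_of_mem_domain h₂.conj hv⟩, ?_⟩
  · intro u hu v hv
    obtain ⟨c, d, hc, hd, -⟩ := exists_tendsto_lagrangeBracket ⟨u, hu⟩ ⟨v, hv⟩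
    exact ⟨⟨c, hc⟩, ⟨d, hd⟩⟩
  · ext u
    exact mem_domain_closure_iff h₁ h₂ hs u
  · ext v
    refine (mem_domain_closure_iff h₂.conj h₁.conj hs.conj v).trans ?_
    rw [hplusOp]
    refine and_congr_right fun hv => forall₂_congr fun u hu => ?_
    rw [hplus v u hu hv, neg_eq_zero, map_eq_zero]
  · rintro ⟨f, hf⟩ u hu
    exact inner_domRestrict_self h₁ h₂ hs ⟨f, hf.2⟩ hf.1 hu
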